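/- Let $G$ be a finite group, $p$ a prime, $K$ a finite extension of $\mathbb{Q}_p$ such that $KH$ is split for every subgroup $H$ of $G$, $\mathcal{O}$ the integral closure of $\mathbb{Z}_p$ in $K$, $\mathfrak{p}$ its maximal ideal and $k=\mathcal{O}/\mathfrak{p}$. A block idempotent of $\mathcal{O}H$ is a primitive idempotent of its centre; for a central idempotent $\beta$ of $\mathcal{O}H$, $\mathrm{Irr}(KH\beta)$ is the set of irreducible characters of $H$ over $K$ afforded by modules on which $\beta$ acts as the identity. Let $\mathbf{K}_G(G)$ be the Grothendieck ring of the category of $G$-equivariant finite dimensional $K$-vector bundles on $G$ ($G$ acting on itself by conjugation), with the product induced by convolution, $(V*W)_a=\bigoplus_{yz=a}V_y\otimes W_z$. Let $\mathcal{M}(G)$ be the set of $G$-orbits of pairs $(g,\gamma)$ with $g\in G$ and $\gamma\in\mathrm{Irr}(KC_G(g))$. For such a pair, let $\Psi_{g,\gamma}:K\otimes_{\mathbb{Z}}\mathbf{K}_G(G)\to K$ be the $K$-linear map $$\Psi_{g,\gamma}([V])=\frac{1}{\gamma(1)}\sum_{a\in C_G(g)}\gamma(a)\,\mathrm{Tr}(g,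 V_a);$$ equivalently, if $V_{h,\eta}$ is the class of the simple bundle supported on the conjugacy class of $h$ whose fibre at $h$ affords $\eta\in\mathrm{Irr}(KC_G(h))$, then $$\Psi_{g,\gamma}(V_{h,\eta})=\frac{1}{\gamma(1)\,|C_G(h)|}\sum_{x\in G,\ xhx^{-1}\in C_G(g)}\eta(x^{-1}gx)\,\gamma(xhx^{-1}).$$ It depends only on the orbit of $(g,\gamma)$. A $p$-block of $\mathcal{M}(G)$ is a set of the form $\{(g,\gamma)\in\mathcal{M}(G) : \Psi_{g,\gamma}(b)=1\}$, where $b$ is a primitive idempotent of $\mathcal{O}\otimes_{\mathbb{Z}}\mathbf{K}_G(G)$. Let $s\in G$ be an element of order prime to $p$ and let $e$ be a block idempotent of $\mathcal{O}C_G(s)$. For $g\in G$ with $p'$-part $g_{p'}=s$, let $\mathrm{Br}_g^k:kC_G(s)\to kC_G(g)$ be the $k$-linear map that is the identity on $C_G(g)$ and maps the elements of $C_G(s)\setminus C_G(g)$ to $0$. Let $\beta_g^{\mathcal{O}}(e)$ be the sum of the block idempotents of $\mathcal{O}C_G(g)$ whose reductions modulo $\mathfrak{p}$ are the distinct block idempotents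 of $kC_G(g)$ with sum $\mathrm{Br}_g^k(\bar e)$. Let $\mathcal{B}_G(s,e)\subseteq\mathcal{M}(G)$ be the set of orbits of the pairs $(g,\gamma)$ such that $g_{p'}=s$ and $\gamma\in\mathrm{Irr}(KC_G(g)\beta_g^{\mathcal{O}}(e))$. Then any two elements of $\mathcal{B}_G(s,e)$ lie in the same $p$-block of $\mathcal{M}(G)$. Moreover, if $(g,\gamma)\in\mathcal{B}_G(s,e)$ and $\sigma\in\mathrm{Irr}(KC_G(s)e)$, then $\Psi_{g,\gamma}(z)\equiv\Psi_{s,\sigma}(z)\pmod{\mathfrak{p}}$ for all $z\in\mathcal{O}\otimes_{\mathbb{Z}}\mathbf{K}_G(G)$. -/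

import Mathlib

open scoped TensorProduct DirectSum

universe u v

noncomputable section

/-- A `G`-equivariant finite dimensional `K`-vector bundle on the finite set `G`, for the action of
`G` on itself by conjugation: a finite dimensional fibre over each point, and for every
`x` and all `a`, `b` with `x * a * x⁻¹ = b` (written `SemiconjBy x a b`, i.e. `x * a = b * x`)
a linear map from the fibre over `a` to the fibre over `b`, subject to the axioms of an action. -/
structure EqBundle (G : Type u) (K : Type v) [Group G] [Field K] where
  fib : G → Type (max u v)
  [addCommGroup : ∀ a, AddCommGroup (fib a)]
  [module : ∀ a, Module K (fib a)]
  [finite : ∀ a, Module.Finite K (fib a)]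
  act : ∀ (x : G) {a b : G}, SemiconjBy x a b → (fib a →ₗ[K] fib b)
  act_one : ∀ {a : G} (h : SemiconjBy 1 a a) (m : fib a), act 1 h m = m
  act_act : ∀ {x y a b c : G} (hy : SemiconjBy y b c) (hx : SemiconjBy x a b)
    (h : SemiconjBy (y * x) a c) (m : fib a), act y hy (act x hx m) = act (y * x) h m

namespace EqBundle

attribute [instance] EqBundle.addCommGroup EqBundle.module EqBundle.finite

section Basic

variable {G : Type u} {K : Type v} [Group G] [Field K]

/-- Morphisms of equivariant bundles. -/
structure Hom (V W : EqBundle G K) where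
  app : ∀ a : G, V.fib a →ₗ[K] W.fib a
  comm : ∀ (x : G) {a b : G} (h : SemiconjBy x a b) (m : V.fib a),
    app b (V.act x h m) = W.act x h (app a m)

/-- `0 → V₁ → V → V₂ → 0` is a short exact sequence of equivariant bundles. -/
def ShortExact {V₁ V V₂ : EqBundle G K} (i : Hom V₁ V) (q : Hom V V₂) : Prop :=
  ∀ a : G, Function.Injective (i.app a) ∧ Function.Exact (i.app a) (q.app a) ∧
    Function.Surjective (q.app a)

/-- The pairs `(y, z)` with `y * z = a`. -/
abbrev FactPair (a : G) : Type u := {p : G × G // p.1 * p.2 = a}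

/-- Conjugation by `x` on factorizations. -/
def FactPair.conj (x : G) {a b : G} (h : SemiconjBy x a b) (p : FactPair a) : FactPair b :=
  ⟨(x * p.1.1 * x⁻¹, x * p.1.2 * x⁻¹), by
    have h1 := h.eq
    rw [← p.2] at h1
    simp only [mul_assoc, inv_mul_cancel_left] at h1 ⊢
    simp [← mul_assoc] at h1 ⊢
    simp [h1]⟩

theorem semiconj_conj (x y : G) : SemiconjBy x y (x * y * x⁻¹) := by
  simp [SemiconjBy]

open Classical in
/-- The action of `x` on the fibres of the convolution product. -/
def convAct (V W : EqBundle G K) (x : G) {a b : G} (h : SemiconjBy x a b) :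
    (⨁ p : FactPair a, V.fib p.1.1 ⊗[K] W.fib p.1.2) →ₗ[K]
      (⨁ p : FactPair b, V.fib p.1.1 ⊗[K] W.fib p.1.2) :=
  DirectSum.toModule K _ _ fun p =>
    DirectSum.lof K (FactPair b) (fun p => V.fib p.1.1 ⊗[K] W.fib p.1.2) (p.conj x h) ∘ₗ
      TensorProduct.map (V.act x (semiconj_conj x p.1.1)) (W.act x (semiconj_conj x p.1.2))

open Classical in
/-- The element `m ⊗ n` of the fibre over `a = y * z` of the convolution product. -/
def convMk (V W : EqBundle G K) {y z a : G} (h : y * z = a) :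
    V.fib y →ₗ[K] W.fib z →ₗ[K] (⨁ p : FactPair a, V.fib p.1.1 ⊗[K] W.fib p.1.2) :=
  (TensorProduct.mk K (V.fib y) (W.fib z)).compr₂
    (DirectSum.lof K (FactPair a) (fun p => V.fib p.1.1 ⊗[K] W.fib p.1.2) ⟨(y, z), h⟩)

open Classical in
theorem conv_hom_ext {V W : EqBundle G K} {a : G} {M : Type*} [AddCommGroup M] [Module K M]
    {f g : (⨁ p : FactPair a, V.fib p.1.1 ⊗[K] W.fib p.1.2) →ₗ[K] M}
    (h : ∀ (y z : G) (hyz : y * z = a) (m : V.fib y) (n : W.fib z),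
      f (convMk V W hyz m n) = g (convMk V W hyz m n)) : f = g := by
  refine DirectSum.linearMap_ext K fun p => ?_
  refine TensorProduct.ext' fun m n => ?_
  exact h p.1.1 p.1.2 p.2 m n

open Classical in
/-- Linear maps out of a fibre of the convolution product. -/
def convLift {V W : EqBundle G K} {a : G} {M : Type*} [AddCommGroup M] [Module K M]
    (f : ∀ (y z : G), y * z = a → (V.fib y →ₗ[K] W.fib z →ₗ[K] M)) :
    (⨁ p : FactPair a, V.fib p.1.1 ⊗[K] W.fib p.1.2) →ₗ[K] M :=
  DirectSum.toModule K _ _ fun p => TensorProduct.lift (f p.1.1 p.1.2 p.2)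

open Classical in
theorem convLift_mk {V W : EqBundle G K} {a : G} {M : Type*} [AddCommGroup M] [Module K M]
    (f : ∀ (y z : G), y * z = a → (V.fib y →ₗ[K] W.fib z →ₗ[K] M))
    {y z : G} (h : y * z = a) (m : V.fib y) (n : W.fib z) :
    convLift f (convMk V W h m n) = f y z h m n := by
  simp only [convLift, convMk, LinearMap.compr₂_apply, TensorProduct.mk_apply]
  erw [DirectSum.toModule_lof]
  simp

theorem convAct_mk (V W : EqBundle G K) (x : G) {a b y z y' z' : G} (h : SemiconjBy x a b)
    (hyz : y * z = a) (hyz' : y' * z' = b) (hy : SemiconjBy x y y') (hz : SemiconjBy x z z')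
    (m : V.fib y) (n : W.fib z) :
    convAct V W x h (convMk V W hyz m n) = convMk V W hyz' (V.act x hy m) (W.act x hz n) := by
  obtain rfl : x * y * x⁻¹ = y' := by rw [hy.eq]; simp
  obtain rfl : x * z * x⁻¹ = z' := by rw [hz.eq]; simp
  simp only [convAct, convMk, LinearMap.compr₂_apply, TensorProduct.mk_apply]
  erw [DirectSum.toModule_lof]
  rfl

/-- The convolution product of equivariant bundles: the fibre over `a` of `V * W` is
`⨁_{y z = a} V_y ⊗ W_z`, with the diagonal action of `G`. -/
def conv [Finite G] (V W : EqBundle G K) : EqBundle G K where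
  fib a := ⨁ p : FactPair a, V.fib p.1.1 ⊗[K] W.fib p.1.2
  finite a := by
    have := Fintype.ofFinite (FactPair a)
    infer_instance
  act x a b h := convAct V W x h
  act_one {a} h m := by
    refine LinearMap.congr_fun (g := LinearMap.id) (conv_hom_ext fun y z hyz m n => ?_) m
    rw [convAct_mk V W 1 h hyz hyz (SemiconjBy.one_left y) (SemiconjBy.one_left z)]
    simp [V.act_one, W.act_one]
  act_act {x y a b c} hy hx h m := by
    refine LinearMap.congr_fun (f := convAct V W y hy ∘ₗ convAct V W x hx)
      (conv_hom_ext fun s t hst m n => ?_) m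
    have e1 : x * s * x⁻¹ * (x * t * x⁻¹) = b := (FactPair.conj x hx ⟨(s, t), hst⟩).2
    have e2 : y * (x * s * x⁻¹) * y⁻¹ * (y * (x * t * x⁻¹) * y⁻¹) = c :=
      (FactPair.conj y hy ⟨(x * s * x⁻¹, x * t * x⁻¹), e1⟩).2
    have k1 := (semiconj_conj y _).mul_left (semiconj_conj x s)
    have k2 := (semiconj_conj y _).mul_left (semiconj_conj x t)
    rw [LinearMap.comp_apply, convAct_mk V W x hx hst e1 (semiconj_conj _ _) (semiconj_conj _ _),
      convAct_mk V W y hy e1 e2 (semiconj_conj _ _) (semiconj_conj _ _),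
      convAct_mk V W (y * x) h hst e2 k1 k2,
      V.act_act _ _ k1, W.act_act _ _ k2]

/-- The unit of the convolution product: the trivial representation `K` placed over `1`. -/
def unit (G : Type u) (K : Type v) [Group G] [Field K] : EqBundle G K where
  fib a := PLift (a = 1) → ULift.{u} K
  act x a b h := LinearMap.funLeft K _ fun hb => ⟨by
    have := h.eq; rw [hb.down] at this; simpa using this⟩
  act_one h m := rfl
  act_act _ _ _ m := rfl



theorem conj_mul_eq {x a b y z : G} (h : SemiconjBy x a b) (hyz : y * z = a) :
    x * y * x⁻¹ * (x * z * x⁻¹) = b := (FactPair.conj x h ⟨(y, z), hyz⟩).2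

theorem act_congr (V : EqBundle G K) {x y a b : G} (e : x = y) (hx : SemiconjBy x a b)
    (hy : SemiconjBy y a b) (m : V.fib a) : V.act x hx m = V.act y hy m := by
  subst e; rfl

/-- The element `1` of the fibre over `1` of the unit bundle. -/
def unitElt (G : Type u) (K : Type v) [Group G] [Field K] : (unit G K).fib 1 :=
  fun _ : PLift ((1 : G) = 1) => (⟨1⟩ : ULift.{u} K)

/-- The coordinate of an element of the fibre over `y = 1` of the unit bundle. -/
def unitCoord {y : G} (hy : y = 1) : (unit G K).fib y →ₗ[K] K :=
  ULift.moduleEquiv.toLinearMap ∘ₗ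
    (LinearMap.proj (R := K) (φ := fun _ : PLift (y = 1) => ULift.{u} K) ⟨hy⟩)

theorem unit_eq (c : (unit G K).fib 1) : unitCoord rfl c • unitElt G K = c := by
  refine funext fun i : PLift ((1 : G) = 1) => ULift.ext _ _ ?_
  exact mul_one _

theorem unitCoord_unitElt : unitCoord rfl (unitElt G K) = 1 := rfl

section Api

variable [Finite G] {U V W : EqBundle G K}

/-- `m ⊗ n` in the fibre over `a = y * z` of the convolution product. -/
def cmk (V W : EqBundle G K) {y z a : G} (h : y * z = a) :
    V.fib y →ₗ[K] W.fib z →ₗ[K] (conv V W).fib a := convMk V W h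

theorem conv_ext {a : G} {M : Type*} [AddCommGroup M] [Module K M]
    {f g : (conv V W).fib a →ₗ[K] M}
    (h : ∀ (y z : G) (hyz : y * z = a) (m : V.fib y) (n : W.fib z),
      f (cmk V W hyz m n) = g (cmk V W hyz m n)) : f = g := conv_hom_ext h

/-- Linear maps out of a fibre of the convolution product. -/
def clift {a : G} {M : Type*} [AddCommGroup M] [Module K M]
    (f : ∀ (y z : G), y * z = a → (V.fib y →ₗ[K] W.fib z →ₗ[K] M)) :
    (conv V W).fib a →ₗ[K] M := convLift f

theorem clift_mk {a : G} {M : Type*} [AddCommGroup M] [Module K M]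
    (f : ∀ (y z : G), y * z = a → (V.fib y →ₗ[K] W.fib z →ₗ[K] M))
    {y z : G} (h : y * z = a) (m : V.fib y) (n : W.fib z) :
    clift f (cmk V W h m n) = f y z h m n := convLift_mk f h m n

theorem conv_act (x : G) {a b y z y' z' : G} (h : SemiconjBy x a b)
    (hyz : y * z = a) (hyz' : y' * z' = b) (hy : SemiconjBy x y y') (hz : SemiconjBy x z z')
    (m : V.fib y) (n : W.fib z) :
    (conv V W).act x h (cmk V W hyz m n) = cmk V W hyz' (V.act x hy m) (W.act x hz n) :=
  convAct_mk V W x h hyz hyz' hy hz m n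

/-- A morphism out of a convolution product, from its values on generators. -/
def homOfConv {T : EqBundle G K} (f : ∀ a, (conv V W).fib a →ₗ[K] T.fib a)
    (hf : ∀ (x : G) {a b : G} (h : SemiconjBy x a b) (y z : G) (hyz : y * z = a)
      (m : V.fib y) (n : W.fib z),
      f b (cmk V W (conj_mul_eq h hyz) (V.act x (semiconj_conj x y) m)
        (W.act x (semiconj_conj x z) n)) = T.act x h (f a (cmk V W hyz m n))) :
    Hom (conv V W) T where
  app := f
  comm x {a b} h m := by
    have key : f b ∘ₗ (conv V W).act x h = T.act x h ∘ₗ f a := conv_ext fun y z hyz m n => by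
      rw [LinearMap.comp_apply, LinearMap.comp_apply, ← hf x h y z hyz m n,
        conv_act x h hyz (conj_mul_eq h hyz) (semiconj_conj x y) (semiconj_conj x z)]
    exact LinearMap.congr_fun key m

/-- The map `m ⊗ n ↦ (y · n) ⊗ m` for `m` in the fibre over `y`. -/
def commApp (V W : EqBundle G K) (a : G) : (conv V W).fib a →ₗ[K] (conv W V).fib a :=
  clift fun y z h =>
    ((cmk W V (y := y * z * y⁻¹) (z := y) (a := a) (by simpa using h)) ∘ₗ
      W.act y (semiconj_conj y z)).flip

theorem commApp_mk {y z y' a : G} (h : y * z = a) (h' : y' * y = a) (k : SemiconjBy y z y')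
    (m : V.fib y) (n : W.fib z) :
    commApp V W a (cmk V W h m n) = cmk W V h' (W.act y k n) m := by
  obtain rfl : y * z * y⁻¹ = y' := by rw [k.eq]; simp
  rw [commApp, clift_mk]
  rfl

/-- Commutativity isomorphism. -/
def commHom (V W : EqBundle G K) : Hom (conv V W) (conv W V) :=
  homOfConv (commApp V W) fun x a b h s t hst m n => by
    have e1 := conj_mul_eq h hst
    have e2 : s * t * s⁻¹ * s = a := by simpa using hst
    have e3 : x * s * x⁻¹ * (x * t * x⁻¹) * (x * s * x⁻¹)⁻¹ * (x * s * x⁻¹) = b := by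
      rw [inv_mul_cancel_right, e1]
    have k : SemiconjBy x (s * t * s⁻¹) (x * s * x⁻¹ * (x * t * x⁻¹) * (x * s * x⁻¹)⁻¹) := by
      simp [SemiconjBy, mul_assoc]
    have k2 : SemiconjBy (x * s) t (x * s * x⁻¹ * (x * t * x⁻¹) * (x * s * x⁻¹)⁻¹) := by
      simp [SemiconjBy, mul_assoc]
    have k3 : SemiconjBy (x * s * x⁻¹ * x) t
        (x * s * x⁻¹ * (x * t * x⁻¹) * (x * s * x⁻¹)⁻¹) := by
      simp [SemiconjBy, mul_assoc]
    rw [commApp_mk e1 e3 (semiconj_conj _ _), commApp_mk hst e2 (semiconj_conj _ _),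
      conv_act x h e2 e3 k (semiconj_conj _ _),
      W.act_act _ _ k2, W.act_act _ _ k3, act_congr W (by simp) k3 k2]

/-- The inverse of `commApp`. -/
def commInv (V W : EqBundle G K) (a : G) : (conv W V).fib a →ₗ[K] (conv V W).fib a :=
  clift fun y z h =>
    ((cmk V W (y := z) (z := z⁻¹ * y * z) (a := a) (by simpa [← mul_assoc] using h)).flip ∘ₗ
      W.act z⁻¹ (by simp [SemiconjBy, mul_assoc]))

theorem commInv_mk {y z y' a : G} (h : y * z = a) (h' : z * y' = a) (k : SemiconjBy z⁻¹ y y')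
    (m : V.fib z) (n : W.fib y) :
    commInv V W a (cmk W V h n m) = cmk V W h' m (W.act z⁻¹ k n) := by
  obtain rfl : z⁻¹ * y * z = y' := by rw [k.eq]; simp
  rw [commInv, clift_mk]
  rfl

theorem commHom_bijective (V W : EqBundle G K) (a : G) :
    Function.Bijective ((commHom V W).app a) := by
  have h1 : commInv V W a ∘ₗ commApp V W a = LinearMap.id := conv_ext fun s t hst m n => by
    have e2 : s * t * s⁻¹ * s = a := by simpa using hst
    have k : SemiconjBy s⁻¹ (s * t * s⁻¹) t := by simp [SemiconjBy, mul_assoc]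
    rw [LinearMap.comp_apply, commApp_mk hst e2 (semiconj_conj _ _), commInv_mk e2 hst k,
      W.act_act _ _ (by simp), act_congr W (inv_mul_cancel s) _ (SemiconjBy.one_left t), W.act_one,
      LinearMap.id_apply]
  have h2 : commApp V W a ∘ₗ commInv V W a = LinearMap.id := conv_ext fun s t hst m n => by
    have e2 : t * (t⁻¹ * s * t) = a := by simpa [← mul_assoc] using hst
    have k : SemiconjBy t⁻¹ s (t⁻¹ * s * t) := by simp [SemiconjBy, mul_assoc]
    have k' : SemiconjBy t (t⁻¹ * s * t) s := by simp [SemiconjBy, mul_assoc]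
    rw [LinearMap.comp_apply, commInv_mk hst e2 k, commApp_mk e2 hst k',
      W.act_act _ _ (by simp), act_congr W (mul_inv_cancel t) _ (SemiconjBy.one_left s), W.act_one,
      LinearMap.id_apply]
  exact Function.bijective_iff_has_inverse.2
    ⟨commInv V W a, LinearMap.congr_fun h1, LinearMap.congr_fun h2⟩

/-- The map `(l ⊗ m) ⊗ n ↦ l ⊗ (m ⊗ n)`. -/
def assocApp (U V W : EqBundle G K) (a : G) :
    (conv (conv U V) W).fib a →ₗ[K] (conv U (conv V W)).fib a :=
  clift fun y z h => clift fun s t hst => LinearMap.mk₂ K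
      (fun l m => (cmk U (conv V W) (y := s) (z := t * z) (a := a)
        (by rw [← mul_assoc, hst, h]) l) ∘ₗ cmk V W rfl m)
      (fun _ _ _ => by rw [map_add, LinearMap.add_comp])
      (fun _ _ _ => by rw [map_smul, LinearMap.smul_comp])
      (fun _ _ _ => by rw [map_add, LinearMap.comp_add])
      (fun _ _ _ => by rw [map_smul, LinearMap.comp_smul])

theorem assocApp_mk {s t y z r a : G} (hst : s * t = y) (h : y * z = a) (htz : t * z = r)
    (h' : s * r = a) (l : U.fib s) (m : V.fib t) (n : W.fib z) :
    assocApp U V W a (cmk (conv U V) W h (cmk U V hst l m) n) =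
      cmk U (conv V W) h' l (cmk V W htz m n) := by
  subst htz
  rw [assocApp, clift_mk, clift_mk]
  rfl

/-- The map `l ⊗ (m ⊗ n) ↦ (l ⊗ m) ⊗ n`. -/
def assocInv (U V W : EqBundle G K) (a : G) :
    (conv U (conv V W)).fib a →ₗ[K] (conv (conv U V) W).fib a :=
  clift fun s r h => (clift fun t z htz => LinearMap.mk₂ K
      (fun m n => (cmk (conv U V) W (y := s * t) (z := z) (a := a)
        (by rw [mul_assoc, htz, h])).flip n ∘ₗ (cmk U V rfl).flip m)
      (fun _ _ _ => by rw [map_add, LinearMap.comp_add])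
      (fun _ _ _ => by rw [map_smul, LinearMap.comp_smul])
      (fun _ _ _ => by rw [map_add, LinearMap.add_comp])
      (fun _ _ _ => by rw [map_smul, LinearMap.smul_comp])).flip

theorem assocInv_mk {s t y z r a : G} (hst : s * t = y) (h : y * z = a) (htz : t * z = r)
    (h' : s * r = a) (l : U.fib s) (m : V.fib t) (n : W.fib z) :
    assocInv U V W a (cmk U (conv V W) h' l (cmk V W htz m n)) =
      cmk (conv U V) W h (cmk U V hst l m) n := by
  subst hst
  rw [assocInv, clift_mk, LinearMap.flip_apply, clift_mk]
  rfl

theorem conv₃_ext {a : G} {M : Type*} [AddCommGroup M] [Module K M]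
    {f g : (conv (conv U V) W).fib a →ₗ[K] M}
    (H : ∀ (s t y z : G) (hst : s * t = y) (h : y * z = a) (l : U.fib s) (m : V.fib t)
      (n : W.fib z), f (cmk (conv U V) W h (cmk U V hst l m) n) =
        g (cmk (conv U V) W h (cmk U V hst l m) n)) : f = g :=
  conv_ext fun y z h q n => by
    have : f ∘ₗ (cmk (conv U V) W h).flip n = g ∘ₗ (cmk (conv U V) W h).flip n :=
      conv_ext fun s t hst l m => H s t y z hst h l m n
    exact LinearMap.congr_fun this q

theorem conv₃_ext' {a : G} {M : Type*} [AddCommGroup M] [Module K M]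
    {f g : (conv U (conv V W)).fib a →ₗ[K] M}
    (H : ∀ (s t z r : G) (htz : t * z = r) (h : s * r = a) (l : U.fib s) (m : V.fib t)
      (n : W.fib z), f (cmk U (conv V W) h l (cmk V W htz m n)) =
        g (cmk U (conv V W) h l (cmk V W htz m n))) : f = g :=
  conv_ext fun s r h l q => by
    have : f ∘ₗ cmk U (conv V W) h l = g ∘ₗ cmk U (conv V W) h l :=
      conv_ext fun t z htz m n => H s t z r htz h l m n
    exact LinearMap.congr_fun this q

/-- Associativity isomorphism. -/
def assocHom (U V W : EqBundle G K) : Hom (conv (conv U V) W) (conv U (conv V W)) where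
  app := assocApp U V W
  comm x {a b} h m := by
    have key : assocApp U V W b ∘ₗ (conv (conv U V) W).act x h =
        (conv U (conv V W)).act x h ∘ₗ assocApp U V W a :=
      conv₃_ext fun s t y z hst hyz l m n => by
        have e1 := conj_mul_eq h hyz
        have e2 := conj_mul_eq (semiconj_conj x y) hst
        have e3 : s * (t * z) = a := by rw [← mul_assoc, hst, hyz]
        have e4 : x * s * x⁻¹ * (x * t * x⁻¹ * (x * z * x⁻¹)) = b := by
          rw [← mul_assoc, e2, e1]
        rw [LinearMap.comp_apply, LinearMap.comp_apply,
          conv_act x h hyz e1 (semiconj_conj _ _) (semiconj_conj _ _),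
          conv_act x _ hst e2 (semiconj_conj _ _) (semiconj_conj _ _),
          assocApp_mk hst hyz rfl e3, assocApp_mk e2 e1 rfl e4,
          conv_act x h e3 e4 (semiconj_conj _ _)
            ((semiconj_conj _ _).mul_right (semiconj_conj _ _)),
          conv_act x _ rfl rfl (semiconj_conj _ _) (semiconj_conj _ _)]
    exact LinearMap.congr_fun key m

theorem assocHom_bijective (U V W : EqBundle G K) (a : G) :
    Function.Bijective ((assocHom U V W).app a) := by
  have h1 : assocInv U V W a ∘ₗ assocApp U V W a = LinearMap.id :=
    conv₃_ext fun s t y z hst h l m n => by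
      have h' : s * (t * z) = a := by rw [← mul_assoc, hst, h]
      rw [LinearMap.comp_apply, assocApp_mk hst h rfl h', assocInv_mk hst h, LinearMap.id_apply]
  have h2 : assocApp U V W a ∘ₗ assocInv U V W a = LinearMap.id :=
    conv₃_ext' fun s t z r htz h l m n => by
      have h' : s * t * z = a := by rw [mul_assoc, htz, h]
      rw [LinearMap.comp_apply, assocInv_mk rfl h' htz h, assocApp_mk rfl h' htz h,
        LinearMap.id_apply]
  exact Function.bijective_iff_has_inverse.2
    ⟨assocInv U V W a, LinearMap.congr_fun h1, LinearMap.congr_fun h2⟩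

/-- Unit isomorphism `m ↦ 1 ⊗ m`. -/
def unitHom (V : EqBundle G K) : Hom V (conv (unit G K) V) where
  app a := cmk (unit G K) V (one_mul a) (unitElt G K)
  comm x a b h m := by
    rw [conv_act x h (one_mul a) (one_mul b) (SemiconjBy.one_right x) h]
    rfl

open Classical in
/-- The map `c ⊗ m ↦ c • m`. -/
def unitInv (V : EqBundle G K) (a : G) : (conv (unit G K) V).fib a →ₗ[K] V.fib a :=
  clift fun y z h => if hy : y = 1 then
    (LinearMap.lsmul K (V.fib a)).compl₁₂ (unitCoord hy)
      (V.act 1 (by subst hy; simpa [SemiconjBy] using h)) else 0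

theorem unitHom_bijective (V : EqBundle G K) (a : G) :
    Function.Bijective ((unitHom V).app a) := by
  have h0 : ∀ c m, unitInv V a (cmk (unit G K) V (one_mul a) c m) = unitCoord rfl c • m := by
    intro c m
    rw [unitInv, clift_mk, dif_pos rfl]
    simp [V.act_one]
  have h1 : ∀ m, unitInv V a ((unitHom V).app a m) = m := fun m => by
    rw [unitHom, h0, unitCoord_unitElt, one_smul]
  have h2 : (unitHom V).app a ∘ₗ unitInv V a = LinearMap.id := conv_ext fun y z hyz c n => by
    by_cases hy : y = 1
    · subst hy
      obtain rfl : z = a := by simpa using hyz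
      rw [LinearMap.comp_apply, h0]
      conv_rhs => rw [← unit_eq c]
      simp [unitHom]
    · have : c = 0 := funext fun i : PLift (y = 1) => absurd i.down hy
      subst this
      simp
  exact Function.bijective_iff_has_inverse.2 ⟨unitInv V a, h1, LinearMap.congr_fun h2⟩

/-- The map `m ⊗ n ↦ f m ⊗ n` on fibres. -/
def convMapApp {V V' : EqBundle G K} (f : Hom V V') (W : EqBundle G K) (a : G) :
    (conv V W).fib a →ₗ[K] (conv V' W).fib a :=
  DirectSum.lmap fun p : FactPair a => (f.app p.1.1).rTensor (W.fib p.1.2)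

theorem convMapApp_mk {V V' : EqBundle G K} (f : Hom V V') (W : EqBundle G K) {a s t : G}
    (hst : s * t = a) (m : V.fib s) (n : W.fib t) :
    convMapApp f W a (cmk V W hst m n) = cmk V' W hst (f.app s m) n := by
  classical exact DirectSum.lmap_lof _ _ _

/-- Functoriality of the convolution product in its first variable. -/
def Hom.conv {V V' : EqBundle G K} (f : Hom V V') (W : EqBundle G K) :
    Hom (conv V W) (conv V' W) :=
  homOfConv (convMapApp f W) fun x a b h s t hst m n => by
    rw [convMapApp_mk, convMapApp_mk,
      conv_act x h hst (conj_mul_eq h hst) (semiconj_conj _ _) (semiconj_conj _ _), f.comm]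

theorem exact_lmap {ι : Type*} [Finite ι] {A B C : ι → Type*} [∀ i, AddCommGroup (A i)]
    [∀ i, AddCommGroup (B i)] [∀ i, AddCommGroup (C i)] [∀ i, Module K (A i)]
    [∀ i, Module K (B i)] [∀ i, Module K (C i)] (f : ∀ i, A i →ₗ[K] B i) (g : ∀ i, B i →ₗ[K] C i)
    (h : ∀ i, Function.Exact (f i) (g i)) :
    Function.Exact (DirectSum.lmap f) (DirectSum.lmap g) := by
  intro y
  constructor
  · intro hy
    have h1 : ∀ p, ∃ z, f p z = y p := fun p => by
      refine (h p _).1 ?_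
      rw [← DirectSum.lmap_apply, hy, DirectSum.zero_apply]
    choose z hz using h1
    have := Fintype.ofFinite ι
    classical
    refine ⟨(DirectSum.linearEquivFunOnFintype K ι A).symm z, ?_⟩
    refine DFinsupp.ext fun p => ?_
    refine Eq.trans ?_ (hz p)
    refine (DirectSum.lmap_apply _ _ _).trans ?_
    congr 1
  · rintro ⟨z, rfl⟩
    refine DFinsupp.ext fun p => ?_
    exact (h p).apply_apply_eq_zero _

theorem ShortExact.conv {V₁ V V₂ : EqBundle G K} {i : Hom V₁ V} {q : Hom V V₂}
    (h : ShortExact i q) (W : EqBundle G K) : ShortExact (i.conv W) (q.conv W) := by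
  intro a
  refine ⟨?_, ?_, ?_⟩
  · refine (DirectSum.lmap_injective _).2 fun p => ?_
    exact Module.Flat.rTensor_preserves_injective_linearMap _ (h _).1
  · exact exact_lmap _ _ fun p => rTensor_exact _ (h _).2.1 (h _).2.2
  · refine (DirectSum.lmap_surjective _).2 fun p => ?_
    exact LinearMap.rTensor_surjective _ (h _).2.2

end Api

end Basic
end EqBundle

section GrothendieckRing

variable (G : Type u) (K : Type v) [Group G] [Field K]

/-- The subgroup generated by `[V] - [V₁] - [V₂]` for all short exact sequences
`0 → V₁ → V → V₂ → 0`. -/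
def KGRel : AddSubgroup (FreeAbelianGroup (EqBundle G K)) :=
  AddSubgroup.closure {z | ∃ (V₁ V V₂ : EqBundle G K) (i : V₁.Hom V) (q : V.Hom V₂),
    EqBundle.ShortExact i q ∧
      z = FreeAbelianGroup.of V - FreeAbelianGroup.of V₁ - FreeAbelianGroup.of V₂}

/-- The Grothendieck group of the category of `G`-equivariant `K`-vector bundles on `G`. -/
def KG : Type (max u v + 1) := FreeAbelianGroup (EqBundle G K) ⧸ KGRel G K

namespace KG

instance : AddCommGroup (KG G K) :=
  inferInstanceAs (AddCommGroup (FreeAbelianGroup (EqBundle G K) ⧸ KGRel G K))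

variable {G K}

/-- The class of an equivariant bundle in the Grothendieck group. -/
def cls (V : EqBundle G K) : KG G K :=
  QuotientAddGroup.mk' (KGRel G K) (FreeAbelianGroup.of V)

theorem cls_exact {V₁ V V₂ : EqBundle G K} {i : V₁.Hom V} {q : V.Hom V₂}
    (h : EqBundle.ShortExact i q) : cls V = cls V₁ + cls V₂ := by
  have h0 : QuotientAddGroup.mk' (KGRel G K)
      (FreeAbelianGroup.of V - FreeAbelianGroup.of V₁ - FreeAbelianGroup.of V₂) = 0 :=
    (QuotientAddGroup.eq_zero_iff _).2 (AddSubgroup.subset_closure ⟨V₁, V, V₂, i, q, h, rfl⟩)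
  rw [map_sub, map_sub, sub_sub, sub_eq_zero] at h0
  exact h0

/-- Additive functions on bundles extend to the Grothendieck group. -/
def lift {A : Type*} [AddCommGroup A] (f : EqBundle G K → A)
    (hf : ∀ (V₁ V V₂ : EqBundle G K) (i : V₁.Hom V) (q : V.Hom V₂),
      EqBundle.ShortExact i q → f V = f V₁ + f V₂) : KG G K →+ A :=
  QuotientAddGroup.lift (KGRel G K) (FreeAbelianGroup.lift f) <| by
    rw [KGRel, AddSubgroup.closure_le]
    rintro _ ⟨V₁, V, V₂, i, q, h, rfl⟩
    simp [hf _ _ _ i q h]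

@[simp]
theorem lift_cls {A : Type*} [AddCommGroup A] (f : EqBundle G K → A)
    (hf : ∀ (V₁ V V₂ : EqBundle G K) (i : V₁.Hom V) (q : V.Hom V₂),
      EqBundle.ShortExact i q → f V = f V₁ + f V₂) (V : EqBundle G K) :
    lift f hf (cls V) = f V :=
  FreeAbelianGroup.lift_apply_of f V

theorem hom_ext {A : Type*} [AddCommGroup A] {f g : KG G K →+ A}
    (h : ∀ V, f (cls V) = g (cls V)) : f = g := by
  exact QuotientAddGroup.addMonoidHom_ext _ (FreeAbelianGroup.lift_ext _ _ h)

/-- The zero bundle. -/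
def zeroBundle (G : Type u) (K : Type v) [Group G] [Field K] : EqBundle G K where
  fib _ := PUnit
  act _ _ _ _ := 0
  act_one _ _ := rfl
  act_act _ _ _ _ := rfl

theorem cls_zero : cls (zeroBundle G K) = 0 := by
  let o : (zeroBundle G K).Hom (zeroBundle G K) := ⟨fun _ => 0, fun _ _ _ _ _ => rfl⟩
  have : EqBundle.ShortExact o o := fun a =>
    ⟨fun _ _ _ => rfl, fun y => ⟨fun _ => ⟨y, rfl⟩, fun _ => rfl⟩, fun y => ⟨y, rfl⟩⟩
  simpa using cls_exact this

theorem cls_eq {V W : EqBundle G K} (f : V.Hom W) (hf : ∀ a, Function.Bijective (f.app a)) :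
    cls V = cls W := by
  let o : (zeroBundle G K).Hom V := ⟨fun _ => 0, fun _ _ _ _ _ => by simp⟩
  have : EqBundle.ShortExact o f := fun a =>
    ⟨fun _ _ _ => rfl, fun y => ⟨fun h => ⟨PUnit.unit,
      ((map_eq_zero_iff _ (hf a).1).1 h).symm⟩,
      by rintro ⟨z, rfl⟩; exact map_zero _⟩, (hf a).2⟩
  simpa [cls_zero] using cls_exact this

variable [Finite G]

theorem cls_conv_comm (V W : EqBundle G K) : cls (V.conv W) = cls (W.conv V) :=
  cls_eq _ (EqBundle.commHom_bijective V W)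

theorem cls_conv_exact {V₁ V V₂ : EqBundle G K} (i : V₁.Hom V) (q : V.Hom V₂)
    (h : EqBundle.ShortExact i q) (W : EqBundle G K) :
    cls (V.conv W) = cls (V₁.conv W) + cls (V₂.conv W) := cls_exact (h.conv W)

/-- Multiplication by the class of `V`. -/
def mulLeft (V : EqBundle G K) : KG G K →+ KG G K :=
  lift (fun W => cls (V.conv W)) fun _ _ _ i q h => by
    rw [cls_conv_comm, cls_conv_exact i q h, cls_conv_comm V, cls_conv_comm V]

theorem mulLeft_cls (V W : EqBundle G K) : mulLeft V (cls W) = cls (V.conv W) :=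
  lift_cls _ _ _

/-- Multiplication on the Grothendieck group, induced by the convolution product. -/
def mulHom : KG G K →+ KG G K →+ KG G K :=
  lift mulLeft fun _ _ _ i q h => hom_ext fun W => by
    rw [AddMonoidHom.add_apply, mulLeft_cls, mulLeft_cls, mulLeft_cls, cls_conv_exact i q h]

theorem mulHom_cls (V W : EqBundle G K) : mulHom (cls V) (cls W) = cls (V.conv W) := by
  rw [mulHom, lift_cls, mulLeft_cls]

theorem mulHom_comm (x y : KG G K) : mulHom x y = mulHom y x := by
  have : (mulHom : KG G K →+ KG G K →+ KG G K) = mulHom.flip :=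
    hom_ext fun V => hom_ext fun W => by
      rw [AddMonoidHom.flip_apply, mulHom_cls, mulHom_cls, cls_conv_comm]
  exact DFunLike.congr_fun (DFunLike.congr_fun this x) y

theorem mulHom_assoc (x y z : KG G K) : mulHom (mulHom x y) z = mulHom x (mulHom y z) := by
  have h1 (V W : EqBundle G K) :
      mulHom (mulHom (cls V) (cls W)) = (mulHom (cls V)).comp (mulHom (cls W)) :=
    hom_ext fun U => by
      rw [AddMonoidHom.comp_apply, mulHom_cls, mulHom_cls, mulHom_cls, mulHom_cls]
      exact cls_eq _ (EqBundle.assocHom_bijective V W U)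
  have h2 (V : EqBundle G K) : (mulHom.flip z).comp (mulHom (cls V)) =
      (mulHom (cls V)).comp (mulHom.flip z) :=
    hom_ext fun W => DFunLike.congr_fun (h1 V W) z
  have h3 : (mulHom.flip z).comp (mulHom.flip y) = mulHom.flip (mulHom y z) :=
    hom_ext fun V => DFunLike.congr_fun (h2 V) y
  exact DFunLike.congr_fun h3 x

theorem mulHom_one (x : KG G K) : mulHom (cls (EqBundle.unit G K)) x = x := by
  have : mulHom (cls (EqBundle.unit G K)) = AddMonoidHom.id (KG G K) :=
    hom_ext fun V => by
      rw [mulHom_cls]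
      exact (cls_eq _ (EqBundle.unitHom_bijective V)).symm
  exact DFunLike.congr_fun this x

/-- The Grothendieck ring of equivariant bundles: `[V] * [W] = [V * W]`. -/
instance : CommRing (KG G K) :=
  { (inferInstance : AddCommGroup (KG G K)) with
    mul := fun x y => mulHom x y
    one := cls (EqBundle.unit G K)
    left_distrib := fun x y z => map_add (mulHom x) y z
    right_distrib := fun x y z => by
      change mulHom (x + y) z = mulHom x z + mulHom y z
      rw [map_add, AddMonoidHom.add_apply]
    zero_mul := fun x => by
      change mulHom 0 x = 0
      rw [map_zero, AddMonoidHom.zero_apply]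
    mul_zero := fun x => map_zero (mulHom x)
    mul_assoc := mulHom_assoc
    one_mul := mulHom_one
    mul_one := fun x => (mulHom_comm _ _).trans (mulHom_one x)
    mul_comm := mulHom_comm }

theorem cls_mul_cls (V W : EqBundle G K) : cls V * cls W = cls (V.conv W) := mulHom_cls V W

end KG

end GrothendieckRing

section Characters

/-- The centralizer `C_G(g)`. -/
abbrev CG {G : Type u} [Group G] (g : G) : Subgroup G := Subgroup.centralizer {g}

theorem CG.commute {G : Type u} [Group G] {g : G} (a : CG g) : SemiconjBy g (a : G) (a : G) :=
  (Subgroup.mem_centralizer_singleton_iff.1 a.2).symm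

/-- `Irr(KH)`: the characters of the irreducible representations of `H` over `K`. -/
def IsIrrChar {H : Type u} {K : Type v} [Group H] [Field K] (χ : H → K) : Prop :=
  ∃ (W : Type v) (_ : AddCommGroup W) (_ : Module K W) (_ : Module.Finite K W)
    (ρ : Representation K H W), ρ.IsIrreducible ∧ ρ.character = χ

/-- `Irr(KHβ)` for a central idempotent `β` of `KH`: the characters of the irreducible
representations of `H` over `K` on which `β` acts as the identity. -/
def IsIrrCharOf {H : Type u} {K : Type v} [Group H] [Field K] (β : MonoidAlgebra K H)
    (χ : H → K) : Prop :=
  ∃ (W : Type v) (_ : AddCommGroup W) (_ : Module K W) (_ : Module.Finite K W)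
    (ρ : Representation K H W), ρ.IsIrreducible ∧ ρ.asAlgebraHom β = 1 ∧ ρ.character = χ

theorem IsIrrCharOf.isIrrChar {H : Type u} {K : Type v} [Group H] [Field K]
    {β : MonoidAlgebra K H} {χ : H → K} (h : IsIrrCharOf β χ) : IsIrrChar χ := by
  obtain ⟨W, i₁, i₂, i₃, ρ, h₁, _, h₂⟩ := h
  exact ⟨W, i₁, i₂, i₃, ρ, h₁, h₂⟩

/-- The group algebra `KH` is split for every subgroup `H` of `G`: the endomorphisms of each
irreducible representation of `H` over `K` are scalars. -/
def SplitForSubgroups (G : Type u) (K : Type v) [Group G] [Field K] : Prop :=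
  ∀ (H : Subgroup G) (W : Type v) [AddCommGroup W] [Module K W] [Module.Finite K W]
    (ρ : Representation K H W), ρ.IsIrreducible →
    ∀ f : W →ₗ[K] W, (∀ h : H, f ∘ₗ ρ h = ρ h ∘ₗ f) → ∃ c : K, f = c • LinearMap.id

/-- `IrrPairs(G)`: the pairs `(g, γ)` with `g ∈ G` and `γ ∈ Irr(K C_G(g))`. -/
structure IrrPair (G : Type u) (K : Type v) [Group G] [Field K] where
  g : G
  γ : CG g → K
  irr : IsIrrChar γ

variable {G : Type u} {K : Type v} [Group G] [Field K]

/-- Conjugation by `x` from `C_G(g)` to `C_G(g')`, where `g' = x * g * x⁻¹`. -/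
def CG.conj {x g g' : G} (h : SemiconjBy x g g') : CG g ≃ CG g' where
  toFun a := ⟨x * a * x⁻¹, by
    rw [Subgroup.mem_centralizer_singleton_iff]
    have e : g' = x * g * x⁻¹ := by rw [h.eq]; simp
    have := CG.commute a
    simp only [SemiconjBy] at this
    simp only [e, mul_assoc, inv_mul_cancel_left]
    rw [← mul_assoc (a : G), ← this, mul_assoc]⟩
  invFun a := ⟨x⁻¹ * a * x, by
    rw [Subgroup.mem_centralizer_singleton_iff]
    have e : g = x⁻¹ * g' * x := by rw [mul_assoc, ← h.eq]; simp
    have := CG.commute a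
    simp only [SemiconjBy] at this
    simp only [e, mul_assoc, mul_inv_cancel_left]
    rw [← mul_assoc (a : G), ← this, mul_assoc]⟩
  left_inv a := by simp [mul_assoc]
  right_inv a := by simp [mul_assoc]

/-- The pairs `P = (g, γ)` and `Q = (g', γ')` are conjugate under `G`:
`g' = x * g * x⁻¹` and `γ' (x * c * x⁻¹) = γ c` for some `x`. -/
def IrrPair.IsConj (P Q : IrrPair G K) : Prop :=
  ∃ (x : G) (h : SemiconjBy x P.g Q.g), ∀ c : CG P.g, Q.γ (CG.conj h c) = P.γ c

variable (G K) in
/-- Being in the same `G`-orbit. -/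
instance IrrPair.setoid : Setoid (IrrPair G K) where
  r := IrrPair.IsConj
  iseqv :=
    { refl := fun P => ⟨1, SemiconjBy.one_left _, fun c => by congr 1; simp [CG.conj]⟩
      symm := by
        rintro P Q ⟨x, h, hx⟩
        refine ⟨x⁻¹, h.inv_symm_left, fun c => ?_⟩
        rw [← hx]
        congr 1
        simp [CG.conj, mul_assoc]
      trans := by
        rintro P Q R ⟨x, h, hx⟩ ⟨y, h', hy⟩
        refine ⟨y * x, h'.mul_left h, fun c => ?_⟩
        rw [← hx, ← hy]
        congr 1
        simp [CG.conj, mul_assoc] }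

variable (G K) in
/-- `ℳ(G)`: the set of `G`-orbits in `IrrPairs(G)`. -/
def MG : Type (max u v) := Quotient (IrrPair.setoid G K)

/-- The orbit of `(g, γ)`. -/
def MG.mk (P : IrrPair G K) : MG G K := Quotient.mk _ P

end Characters

section Psi

variable {G : Type u} {K : Type v} [Group G] [Field K]

/-- The trace of `g` on the fibre over `a ∈ C_G(g)`. -/
def EqBundle.tr (V : EqBundle G K) (g : G) (a : CG g) : K :=
  LinearMap.trace K (V.fib a) (V.act g (CG.commute a))

theorem trace_exact {A B C : Type*} [AddCommGroup A] [Module K A] [AddCommGroup B] [Module K B]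
    [AddCommGroup C] [Module K C] [Module.Finite K A] [Module.Finite K B] [Module.Finite K C]
    {i : A →ₗ[K] B} {q : B →ₗ[K] C} (hi : Function.Injective i) (hiq : Function.Exact i q)
    (hq : Function.Surjective q) {f : A →ₗ[K] A} {g : B →ₗ[K] B} {h : C →ₗ[K] C}
    (h₁ : ∀ m, i (f m) = g (i m)) (h₂ : ∀ m, q (g m) = h (q m)) :
    LinearMap.trace K B g = LinearMap.trace K A f + LinearMap.trace K C h := by
  obtain ⟨s, hs⟩ := q.exists_rightInverse_of_surjective (LinearMap.range_eq_top.2 hq)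
  obtain ⟨r, hr⟩ := i.exists_leftInverse_of_injective (LinearMap.ker_eq_bot.2 hi)
  have hs' : ∀ m, q (s m) = m := LinearMap.congr_fun hs
  have hr' : ∀ m, r (i m) = m := LinearMap.congr_fun hr
  have key : i ∘ₗ r ∘ₗ (LinearMap.id - s ∘ₗ q) + s ∘ₗ q = LinearMap.id := by
    ext m
    have : q (m - s (q m)) = 0 := by simp [hs']
    obtain ⟨n, hn⟩ := (hiq _).1 this
    simp only [LinearMap.add_apply, LinearMap.comp_apply, LinearMap.sub_apply, LinearMap.id_apply]
    rw [← hn, hr', hn]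
    simp
  have e : g = (g ∘ₗ i) ∘ₗ (r ∘ₗ (LinearMap.id - s ∘ₗ q)) + (g ∘ₗ s) ∘ₗ q := by
    conv_lhs => rw [← LinearMap.comp_id g, ← key]
    rw [LinearMap.comp_add]
    rfl
  rw [e, map_add, ← LinearMap.trace_comp_comm', ← LinearMap.trace_comp_comm' (g ∘ₗ s) q]
  congr 2
  · ext m
    simp only [LinearMap.comp_apply, LinearMap.sub_apply, LinearMap.id_apply]
    rw [← h₁, hiq.apply_apply_eq_zero, map_zero, sub_zero, hr']
  · ext m
    simp only [LinearMap.comp_apply]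
    rw [h₂, hs']

theorem EqBundle.tr_conj (V : EqBundle G K) {x g g' : G} (h : SemiconjBy x g g') (a : CG g) :
    V.tr g' (CG.conj h a) = V.tr g a := by
  have k : SemiconjBy x (a : G) (CG.conj h a : CG g') := by simp [CG.conj, SemiconjBy]
  have h1 : V.act g' (CG.commute (CG.conj h a)) =
      V.act x k ∘ₗ (V.act g (CG.commute a) ∘ₗ V.act x⁻¹ k.inv_symm_left) := by
    ext m
    have e : x * (g * x⁻¹) = g' := by rw [← mul_assoc, h.eq]; simp
    have k1 := (CG.commute a).mul_left k.inv_symm_left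
    rw [LinearMap.comp_apply, LinearMap.comp_apply, V.act_act _ _ k1, V.act_act _ _ (k.mul_left k1)]
    exact V.act_congr e.symm _ _ _
  have h2 : (V.act g (CG.commute a) ∘ₗ V.act x⁻¹ k.inv_symm_left) ∘ₗ V.act x k =
      V.act g (CG.commute a) := by
    ext m
    rw [LinearMap.comp_apply, LinearMap.comp_apply, V.act_act _ _ (k.inv_symm_left.mul_left k),
      V.act_congr (inv_mul_cancel x) _ (SemiconjBy.one_left _), V.act_one]
  rw [EqBundle.tr, h1, LinearMap.trace_comp_comm', h2, EqBundle.tr]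

variable [Finite G]

/-- The additive map `K_G(G) → K` with `[V] ↦ γ(1)⁻¹ ∑_{a ∈ C_G(g)} γ(a) Tr(g, V_a)`. -/
def psiHom (P : IrrPair G K) : KG G K →+ K :=
  KG.lift (fun V => (P.γ 1)⁻¹ * ∑ᶠ a : CG P.g, P.γ a * V.tr P.g a) fun V₁ V V₂ i q h => by
    rw [← mul_add, ← finsum_add_distrib (Set.toFinite _) (Set.toFinite _)]
    congr 2
    funext a
    rw [← mul_add]
    congr 1
    exact trace_exact (h a).1 (h a).2.1 (h a).2.2 (fun m => i.comm _ _ m) (fun m => q.comm _ _ m)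

theorem psiHom_cls (P : IrrPair G K) (V : EqBundle G K) :
    psiHom P (KG.cls V) = (P.γ 1)⁻¹ * ∑ᶠ a : CG P.g, P.γ a * V.tr P.g a := by
  rw [psiHom, KG.lift_cls]

theorem psiHom_conj {P Q : IrrPair G K} (h : P.IsConj Q) : psiHom P = psiHom Q := by
  obtain ⟨x, h, hx⟩ := h
  refine KG.hom_ext fun V => ?_
  rw [psiHom, psiHom, KG.lift_cls, KG.lift_cls]
  congr 1
  · rw [← hx]
    congr 2
    simp [CG.conj]
  · rw [← finsum_comp_equiv (CG.conj h)]
    congr 1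
    funext a
    rw [hx, V.tr_conj]

/-- The `K`-linear map `Ψ_{g,γ} : K ⊗ K_G(G) → K`, for an orbit of pairs `(g, γ)`. On the simple
bundles it is given by the Fourier coefficients, see `Psi_orbitBundle`. -/
def Psi (m : MG G K) : K ⊗[ℤ] KG G K →ₗ[K] K :=
  LinearMap.liftBaseChange K
    (Quotient.lift psiHom (fun _ _ h => psiHom_conj h) m).toIntLinearMap

end Psi

section Simple

variable {G : Type u} {K : Type v} [Group G] [Field K]

section Bundle

variable [Finite G] (h : G) {W : Type v} [AddCommGroup W] [Module K W] [Module.Finite K W]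
  (ρ : Representation K (CG h) W)

/-- The fibre over `a` of the bundle attached to `(h, ρ)`: functions `f` on the set of all `x` with
`x * h * x⁻¹ = a` such that `f (x * c) = ρ(c)⁻¹ (f x)` for `c ∈ C_G(h)`. -/
def orbitFib (a : G) : Submodule K ({x : G // SemiconjBy x h a} → W) where
  carrier := {f | ∀ (x y : {x : G // SemiconjBy x h a}) (c : CG h),
    (y : G) = x * c → ρ c (f y) = f x}
  add_mem' hf hg x y c e := by
    rw [Pi.add_apply, Pi.add_apply, map_add, hf x y c e, hg x y c e]
  zero_mem' x y c e := map_zero _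
  smul_mem' r f hf x y c e := by
    rw [Pi.smul_apply, Pi.smul_apply, map_smul, hf x y c e]

/-- Translation by `y` of functions on the sets `{x | x * h * x⁻¹ = a}`. -/
def orbitAct (y : G) {a b : G} (hy : SemiconjBy y a b) : orbitFib h ρ a →ₗ[K] orbitFib h ρ b :=
  (LinearMap.funLeft K W fun x : {x : G // SemiconjBy x h b} =>
    (⟨y⁻¹ * x, hy.inv_symm_left.mul_left x.2⟩ : {x : G // SemiconjBy x h a})).restrict
    fun f hf x z c e => hf _ _ c (by simp only [e, mul_assoc])

/-- The equivariant bundle `G ×_{C_G(h)} W` supported on the conjugacy class of `h`, whose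
fibre over `h` is the representation `ρ` of `C_G(h)`. When `ρ` is irreducible with character `η`
its class in the Grothendieck ring is `V_{h,η}`. -/
def orbitBundle : EqBundle G K where
  fib a := orbitFib h ρ a
  act y _ _ hy := orbitAct h ρ y hy
  act_one {a} h m := by
    refine Subtype.ext (funext fun x => ?_)
    refine congr_arg m.1 (Subtype.ext ?_)
    simp
  act_act {x y a b c} hy hx h m := by
    refine Subtype.ext (funext fun x => ?_)
    refine congr_arg m.1 (Subtype.ext ?_)
    simp [mul_assoc]

/-- Evaluation at `x` identifies the fibre over `a = x * h * x⁻¹` with `W`. -/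
def orbitEval {a : G} (x : {x : G // SemiconjBy x h a}) : orbitFib h ρ a ≃ₗ[K] W :=
  LinearEquiv.ofBijective (LinearMap.proj x ∘ₗ (orbitFib h ρ a).subtype) <| by
    have hc : ∀ y z : {x : G // SemiconjBy x h a}, (y : G)⁻¹ * z ∈ CG h := fun y z => by
      rw [Subgroup.mem_centralizer_singleton_iff]
      exact (y.2.inv_symm_left.mul_left z.2).eq
    constructor
    · rw [← LinearMap.ker_eq_bot, LinearMap.ker_eq_bot']
      intro f hf
      refine Subtype.ext (funext fun y => ?_)
      have := f.2 y x ⟨_, hc y x⟩ (by simp)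
      rw [← this]
      change f.1 x = 0 at hf
      rw [hf, map_zero]
      rfl
    · intro w
      refine ⟨⟨fun y => ρ ⟨_, hc y x⟩ w, fun y z c e => ?_⟩, ?_⟩
      · rw [← Module.End.mul_apply, ← map_mul]
        congr 2
        ext
        simp [e, mul_assoc]
      · change ρ ⟨_, hc x x⟩ w = w
        have : (⟨_, hc x x⟩ : CG h) = 1 := by ext; simp
        rw [this, map_one, Module.End.one_apply]

theorem orbitBundle_tr {g : G} (a : CG g) (x : {x : G // SemiconjBy x h (a : G)})
    (c : CG h) (hc : (c : G) = (x : G)⁻¹ * g * x) :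
    (orbitBundle h ρ).tr g a = ρ.character c := by
  rw [EqBundle.tr, Representation.character]
  change LinearMap.trace K (orbitFib h ρ a) (orbitAct h ρ g (CG.commute a)) = _
  refine (LinearMap.trace_conj' _ (orbitEval h ρ x)).symm.trans ?_
  congr 1
  ext w
  obtain ⟨f, rfl⟩ := (orbitEval h ρ x).surjective w
  rw [LinearEquiv.conj_apply_apply, LinearEquiv.symm_apply_apply]
  exact (f.2 _ x c (by simp [hc, mul_assoc])).symm

theorem orbitBundle_tr_eq_zero {g : G} (a : CG g) (hx : ∀ x : G, ¬ SemiconjBy x h (a : G)) :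
    (orbitBundle h ρ).tr g a = 0 := by
  have : Subsingleton ((orbitBundle h ρ).fib a) :=
    ⟨fun f f' => Subtype.ext (funext fun x => absurd x.2 (hx x.1))⟩
  rw [EqBundle.tr, Subsingleton.elim ((orbitBundle h ρ).act g _) 0, map_zero]

end Bundle

theorem mem_CG_inv_conj {g h x : G} (hx : x * h * x⁻¹ ∈ CG g) : x⁻¹ * g⁻¹ * x ∈ CG h := by
  have h1 := Subgroup.mem_centralizer_singleton_iff.1 hx
  refine Subgroup.mem_centralizer_singleton_iff.2 ?_
  have h2 : g⁻¹ * (x * h * x⁻¹) = x * h * x⁻¹ * g⁻¹ := by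
    rw [inv_mul_eq_iff_eq_mul, ← mul_assoc, ← h1]
    simp
  calc x⁻¹ * g⁻¹ * x * h = x⁻¹ * (g⁻¹ * (x * h * x⁻¹)) * x := by simp [mul_assoc]
    _ = h * (x⁻¹ * g⁻¹ * x) := by rw [h2]; simp [mul_assoc]

/-- The Fourier coefficient `{(g,γ),(h,η)}`. -/
def lusztigFourier (g : G) (γ : CG g → K) (h : G) (η : CG h → K) : K :=
  1 / ((Nat.card (CG g) : K) * Nat.card (CG h)) *
    ∑ᶠ x : {x : G // x * h * x⁻¹ ∈ CG g},
      γ ⟨x * h * (x : G)⁻¹, x.2⟩ * η ⟨(x : G)⁻¹ * g⁻¹ * x, mem_CG_inv_conj x.2⟩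

/-- `C_G(h⁻¹) = C_G(h)`. -/
def CG.ofInv {h : G} (c : CG h⁻¹) : CG h :=
  ⟨c, by
    have := (CG.commute c).inv_symm_left
    rw [inv_inv] at this
    exact Subgroup.mem_centralizer_singleton_iff.2 this.eq.symm⟩

/-- The defining formula of `Ψ_{g,γ}` on the simple bundles:
`Ψ_{g,γ}(V_{h,η}) = |C_G(g)| / γ(1) * {(h⁻¹,η),(g,γ)}`. -/
theorem Psi_orbitBundle [Finite G] [CharZero K] (P : IrrPair G K) (h : G) {W : Type v}
    [AddCommGroup W] [Module K W] [Module.Finite K W] (ρ : Representation K (CG h) W) :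
    Psi (MG.mk P) (1 ⊗ₜ KG.cls (orbitBundle h ρ)) =
      (Nat.card (CG P.g) : K) / P.γ 1 *
        lusztigFourier h⁻¹ (fun c => ρ.character (CG.ofInv c)) P.g P.γ := by
  classical
  have hL : Psi (MG.mk P) (1 ⊗ₜ KG.cls (orbitBundle h ρ)) =
      (P.γ 1)⁻¹ * ∑ᶠ a : CG P.g, P.γ a * (orbitBundle h ρ).tr P.g a := by
    rw [Psi, LinearMap.liftBaseChange_tmul, one_smul]
    exact psiHom_cls P _
  have := Fintype.ofFinite G
  let X := {x : G // x * P.g * x⁻¹ ∈ CG h⁻¹}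
  let π : X → CG P.g := fun x => ⟨(x : G)⁻¹ * (h⁻¹)⁻¹ * x, mem_CG_inv_conj x.2⟩
  have hcard : Nat.card (CG h⁻¹) = Nat.card (CG h) := by
    congr 2
    ext c
    simp only [Subgroup.mem_centralizer_singleton_iff]
    constructor
    · intro e
      exact (Commute.inv_right_iff.1 e : Commute c h)
    · intro e
      exact (Commute.inv_right_iff.2 e : Commute c h⁻¹)
  have hsum : ∑ᶠ x : X, ρ.character (CG.ofInv ⟨x * P.g * (x : G)⁻¹, x.2⟩) * P.γ (π x) =
      Nat.card (CG h) * ∑ᶠ a : CG P.g, P.γ a * (orbitBundle h ρ).tr P.g a := by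
    rw [finsum_eq_sum_of_fintype, finsum_eq_sum_of_fintype, Finset.mul_sum,
      ← Finset.sum_fiberwise (s := Finset.univ) (g := π)]
    refine Finset.sum_congr rfl fun a _ => ?_
    have hterm : ∀ x ∈ Finset.univ.filter (fun x : X => π x = a),
        ρ.character (CG.ofInv ⟨x * P.g * (x : G)⁻¹, x.2⟩) * P.γ (π x) =
          P.γ a * (orbitBundle h ρ).tr P.g a := by
      intro x hx
      obtain rfl := (Finset.mem_filter.1 hx).2
      rw [mul_comm, orbitBundle_tr h ρ (π x) ⟨(x : G)⁻¹, by simp [π, SemiconjBy, mul_assoc]⟩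
        (CG.ofInv ⟨x * P.g * (x : G)⁻¹, x.2⟩) (by simp [CG.ofInv])]
    rw [Finset.sum_congr rfl hterm, Finset.sum_const, nsmul_eq_mul]
    by_cases hx : ∃ x : G, SemiconjBy x h (a : G)
    · congr 2
      obtain ⟨x₀, hx₀⟩ := hx
      rw [← Fintype.card_subtype, Nat.card_eq_fintype_card]
      have hmem : ∀ y : G, SemiconjBy y (a : G) h → y * P.g * y⁻¹ ∈ CG h⁻¹ := fun y k => by
        have k' := (k.mul_left (CG.commute a)).mul_left k.inv_symm_left
        exact Subgroup.mem_centralizer_singleton_iff.2 k'.inv_right.eq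
      have hπ : ∀ x : X, π x = a ↔ SemiconjBy (x : G) (a : G) h := fun x => by
        rw [Subtype.ext_iff]
        simp only [π, inv_inv, SemiconjBy, mul_assoc, inv_mul_eq_iff_eq_mul]
        exact eq_comm
      refine Fintype.card_congr
        { toFun := fun x => ⟨x.1.1 * x₀, Subgroup.mem_centralizer_singleton_iff.2
            (((hπ x.1).1 x.2).mul_left hx₀).eq⟩
          invFun := fun c => ⟨⟨c * x₀⁻¹, hmem _ ((show SemiconjBy (c : G) h h from (CG.commute c).eq.symm).mul_left hx₀.inv_symm_left)⟩,
            (hπ _).2 ((show SemiconjBy (c : G) h h from (CG.commute c).eq.symm).mul_left hx₀.inv_symm_left)⟩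
          left_inv := fun x => by simp
          right_inv := fun c => by simp }
    · rw [orbitBundle_tr_eq_zero h ρ a (by simpa using hx)]
      simp
  have h1 : (Nat.card (CG h) : K) ≠ 0 := Nat.cast_ne_zero.2 Nat.card_pos.ne'
  have h2 : (Nat.card (CG P.g) : K) ≠ 0 := Nat.cast_ne_zero.2 Nat.card_pos.ne'
  rw [hL, lusztigFourier, hcard]
  erw [hsum]
  field_simp

end Simple

section Blocks

/-- A primitive idempotent: a non-zero idempotent which is not the sum of two non-zero
orthogonal idempotents. -/
def IsPrimitiveIdempotent {R : Type*} [Ring R] (e : R) : Prop :=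
  IsIdempotentElem e ∧ e ≠ 0 ∧ ∀ f f' : R, IsIdempotentElem f → IsIdempotentElem f' →
    f * f' = 0 → f' * f = 0 → e = f + f' → f = 0 ∨ f' = 0

/-- A block idempotent of the group algebra `ΛH`: a primitive idempotent of its centre. -/
def IsBlockIdempotent {Λ H : Type*} [CommRing Λ] [Group H] (e : MonoidAlgebra Λ H) : Prop :=
  ∃ h : e ∈ Subring.center (MonoidAlgebra Λ H),
    IsPrimitiveIdempotent (⟨e, h⟩ : Subring.center (MonoidAlgebra Λ H))

/-- `s` is the `p'`-part of `g`: `g = u * s = s * u` with `u` of `p`-power order and `s` of order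
prime to `p`. -/
def IsPPrimePart {G : Type*} [Group G] (p : ℕ) (g s : G) : Prop :=
  ∃ u : G, g = u * s ∧ g = s * u ∧ (∃ n : ℕ, orderOf u = p ^ n) ∧ (orderOf s).Coprime p

open Classical in
/-- The `Λ`-linear map `ΛH → ΛL` with `h ↦ h` if `h ∈ L` and `h ↦ 0` otherwise. For `H = C_G(s)`
and `L = C_G(g)`, where `s` is the `p'`-part of `g`, this is the Brauer map. -/
def brauerMap {G : Type*} [Group G] (Λ : Type*) [CommRing Λ] (H L : Subgroup G)
    (x : MonoidAlgebra Λ H) : MonoidAlgebra Λ L :=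
  x.coeff.sum fun h r => if hL : (h : G) ∈ L then MonoidAlgebra.single ⟨h, hL⟩ r else 0

variable {G : Type u} {K : Type v} [Group G] [Field K] {O : Type*} [CommRing O]

/-- Reduction `OH → (O/𝔭)H` modulo `𝔭`. -/
def reduction (𝔭 : Ideal O) (H : Type*) [Group H] :
    MonoidAlgebra O H →+* MonoidAlgebra (O ⧸ 𝔭) H :=
  MonoidAlgebra.mapRingHom H (Ideal.Quotient.mk 𝔭)

/-- `β = β_g(e)`, for `e ∈ O C_G(s)`: there is a (necessarily unique) set `S` of block idempotents
of `O C_G(g)` such that the image of `e` mod `𝔭` under the Brauer map `k C_G(s) → k C_G(g)` is the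
sum of the reductions of the elements of `S`, and `β` is the sum of the elements of `S`. -/
def IsBeta (𝔭 : Ideal O) (s g : G) (e : MonoidAlgebra O (CG s)) (β : MonoidAlgebra O (CG g)) :
    Prop :=
  ∃ S : Finset (MonoidAlgebra O (CG g)), (∀ f ∈ S, IsBlockIdempotent f) ∧
    brauerMap (O ⧸ 𝔭) (CG s) (CG g) (reduction 𝔭 (CG s) e) =
      ∑ f ∈ S, reduction 𝔭 (CG g) f ∧
    β = ∑ f ∈ S, f

variable [Algebra O K]

variable (K) in
/-- The inclusion `OH → KH`. -/
def toKAlg (H : Type*) [Group H] : MonoidAlgebra O H →+* MonoidAlgebra K H :=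
  MonoidAlgebra.mapRingHom H (algebraMap O K)

variable (K) in
/-- `𝓑_G(s,e)`: the orbits of the pairs `(g, γ)` such that `g` has `p'`-part `s` and
`γ ∈ Irr(K C_G(g) β_g(e))`. -/
def BlockSet (p : ℕ) (𝔭 : Ideal O) (s : G) (e : MonoidAlgebra O (CG s)) : Set (MG G K) :=
  {m | ∃ P : IrrPair G K, MG.mk P = m ∧ IsPPrimePart p P.g s ∧
    ∃ β : MonoidAlgebra O (CG P.g), IsBeta 𝔭 s P.g e β ∧ IsIrrCharOf (toKAlg K (CG P.g) β) P.γ}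

variable [Finite G]

variable (O G K) in
/-- The canonical map `O ⊗ K_G(G) → K ⊗ K_G(G)`. -/
def toKKG : O ⊗[ℤ] KG G K →ₐ[ℤ] K ⊗[ℤ] KG G K :=
  Algebra.TensorProduct.map (algebraMap O K).toIntAlgHom (AlgHom.id ℤ (KG G K))

variable (O) in
/-- The `p`-blocks of `ℳ(G)`: the sets of all orbits whose associated one-dimensional
`K ⊗ K_G(G)`-module belongs to a given primitive idempotent `b` of `O ⊗ K_G(G)`. -/
def IsPBlock (B : Set (MG G K)) : Prop :=
  ∃ b : O ⊗[ℤ] KG G K, IsPrimitiveIdempotent b ∧ B = {m | Psi m (toKKG G K O b) = 1}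

end Blocks

end

/-! For `g` in `G`, sending a bundle `V` to `V.elt g`, the sum of `Tr(g, V_a) a` over `a` in
`C_G(g)`, turns convolution into the product of the group algebra and lands in its centre. `Ψ_{g,γ}`
is this map followed by the central character `ω_γ`, so it is a ring homomorphism. The traces are
sums of roots of unity, so `V.elt g` has coefficients in `𝒪`, and `ω_γ` maps the centre of `𝒪C_G(g)`
into `𝒪`.

Let `s` be the `p'`-part of `g`. The eigenvalues of `g` and `s` on a fibre differ by roots of unity
of `p`-power order, which are 1 modulo any prime over `𝔭`. Hence `V.elt g` is congruent modulo `𝔭`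
to the truncation of `V.elt s` to `C_G(g)` (`exists_tr_sub_tr_mem`). By Brauer's argument this
truncation is multiplicative modulo `p` on the centre (`coeff_truncate_mul_sub_mem`): `C_G(g)` is
the centralizer in `C_G(s)` of the `p`-part of `g`, and the terms it moves by conjugation cancel
modulo `p`. So `ω_γ` after truncation, reduced modulo `𝔭`, is a ring homomorphism from the centre of
`𝒪C_G(s)` to `k`, and it computes `Ψ_{g,γ}` modulo `𝔭` from `V.elt s` alone. If the pair lies in
`𝓑_G(s,e)`, it maps `e` to 1, since the truncation of `e` is congruent to `β_g(e)`, which acts as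
the identity (`exists_ringHom_of_mem_blockSet`).

As `e` is primitive and idempotents lift, only one homomorphism over `𝒪` from the centre to `k` maps
`e` to 1 (`ringHom_eq_of_isPrimitiveIdempotent`). All elements of `𝓑_G(s,e)` therefore have the same
`Ψ` modulo `𝔭`. For the blocks, take a primitive idempotent on which one `Ψ` is 1; the other is 0 or
1 there and congruent to 1, hence is 1. -/

noncomputable section

/-! ### Lifting idempotents and separating homomorphisms by them. -/

section Idempotents

/-- A finite module over an adically complete Noetherian local ring is adically complete. -/
theorem isAdicComplete_of_finite {R M : Type*} [CommRing R] [IsLocalRing R] [IsNoetherianRing R]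
    [IsAdicComplete (IsLocalRing.maximalIdeal R) R] [AddCommGroup M] [Module R M]
    [Module.Finite R M] : IsAdicComplete (IsLocalRing.maximalIdeal R) M := by
  set I := IsLocalRing.maximalIdeal R
  have : IsPrecomplete I M := by
    -- The completion of a finite module is an image of the completion of `R` tensored with `M`. As
    -- `R` is complete, each pure tensor there comes from an element of `M`.
    refine AdicCompletion.of_surjective_iff.1 fun y => ?_
    obtain ⟨t, rfl⟩ := AdicCompletion.ofTensorProduct_surjective_of_finite I M y
    induction t with
    | zero => exact ⟨0, by simp⟩
    | tmul r x =>
      obtain ⟨r, rfl⟩ := AdicCompletion.of_surjective I R r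
      refine ⟨r • x, ?_⟩
      rw [AdicCompletion.ofTensorProduct_tmul, map_smul]
      ext n
      simp
      rfl
    | add a b ha hb =>
      obtain ⟨a', ha⟩ := ha
      obtain ⟨b', hb⟩ := hb
      exact ⟨a' + b', by rw [map_add, map_add, ha, hb]⟩
  exact ⟨⟩

/-- Idempotents lift along the reduction modulo the maximal ideal of a complete base. -/
theorem exists_isIdempotentElem_sub_mem {R A : Type*} [CommRing R] [IsLocalRing R]
    [IsNoetherianRing R] [IsAdicComplete (IsLocalRing.maximalIdeal R) R] [CommRing A]
    [Algebra R A] [Module.Finite R A] (x : A)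
    (hx : x * x - x ∈ (IsLocalRing.maximalIdeal R).map (algebraMap R A)) :
    ∃ f : A, IsIdempotentElem f ∧ f - x ∈ (IsLocalRing.maximalIdeal R).map (algebraMap R A) := by
  set J := (IsLocalRing.maximalIdeal R).map (algebraMap R A)
  have hA : IsAdicComplete (IsLocalRing.maximalIdeal R) A := isAdicComplete_of_finite
  -- The `J`-adic topology of the ring `A` is its adic topology as an `R`-module.
  have : IsHausdorff J A := IsHausdorff.map_algebraMap_iff.2 inferInstance
  have : IsPrecomplete J A := IsPrecomplete.map_algebraMap_iff.2 inferInstance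
  have : IsAdicComplete J A := ⟨⟩
  obtain ⟨f, hf, hfx⟩ := HenselianRing.is_henselian (I := J)
    (Polynomial.X ^ 2 - Polynomial.X : Polynomial A) (by monicity!) x
    (by simpa [pow_two] using hx) (by
      -- Hensel's lemma needs the derivative `2x - 1` to be a unit modulo `J`; it is its own inverse
      -- there.
      refine IsUnit.of_mul_eq_one (Ideal.Quotient.mk J (2 * x - 1)) ?_
      rw [← map_mul, ← map_one (Ideal.Quotient.mk J), Ideal.Quotient.eq]
      simp only [Polynomial.derivative_sub, Polynomial.derivative_X_pow, Polynomial.derivative_X,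
        Polynomial.eval_sub, Polynomial.eval_mul, Polynomial.eval_X,
        Polynomial.eval_one, Polynomial.eval_C, Nat.cast_ofNat, Nat.add_one_sub_one, pow_one]
      have : (2 * x - 1) * (2 * x - 1) - 1 = 4 * (x * x - x) := by ring
      rw [this]
      exact J.mul_mem_left _ hx)
  refine ⟨f, ?_, hfx⟩
  have : f ^ 2 - f = 0 := by simpa using hf
  rw [IsIdempotentElem, ← pow_two]
  exact sub_eq_zero.1 this

/-- Some positive power of an element of a finite monoid is idempotent. -/
theorem exists_isIdempotentElem_pow {M : Type*} [Monoid M] [Finite M] (x : M) :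
    ∃ n, n ≠ 0 ∧ IsIdempotentElem (x ^ n) := by
  obtain ⟨i, j, hij, h⟩ := Finite.exists_ne_map_eq_of_infinite (fun n : ℕ => x ^ n)
  wlog hlt : i < j generalizing i j
  · exact this j i hij.symm h.symm (by omega)
  obtain ⟨d, rfl⟩ := Nat.exists_eq_add_of_lt hlt
  have h1 : ∀ t, x ^ (i + t * (d + 1)) = x ^ i := by
    intro t
    induction t with
    | zero => simp
    | succ t ih =>
      have : i + (t + 1) * (d + 1) = (i + t * (d + 1)) + (d + 1) := by ring
      rw [this, pow_add, ih, ← pow_add]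
      exact h.symm
  -- This exponent is a multiple of the period `d + 1` and at least `i`, so doubling it does not
  -- change the power. The factor `i + 1` instead of `i` keeps it non-zero.
  refine ⟨(i + 1) * (d + 1), by positivity, ?_⟩
  have h2 : (i + 1) * (d + 1) = i + (i * d + d + 1) := by ring
  rw [IsIdempotentElem, ← pow_add]
  have h3 : (i + 1) * (d + 1) + (i + 1) * (d + 1) =
      (i + (i + 1) * (d + 1)) + (i * d + d + 1) := by ring
  rw [h3, pow_add, h1, ← pow_add, ← h2]

/-- Two homomorphisms from a finite `ℤ_p`-algebra to a field of characteristic `p` which agree on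
enough scalars and both map a given primitive idempotent to `1` coincide. -/
theorem ringHom_eq_of_isPrimitiveIdempotent {p : ℕ} [Fact p.Prime] {A k : Type*} [CommRing A]
    [Algebra ℤ_[p] A] [Module.Finite ℤ_[p] A] [Field k] (hp : (p : k) = 0) {e : A}
    (he : IsPrimitiveIdempotent e) (φ ψ : A →+* k) (hφ : φ e = 1) (hψ : ψ e = 1)
    (h : ∀ x, ∃ c, φ c = φ x ∧ ψ c = φ x) : φ = ψ := by
  refine RingHom.ext fun x => ?_
  by_contra hne
  obtain ⟨c, hc, hc'⟩ := h x
  -- Subtracting `c` gives an element killed by `φ` but not by `ψ`; a suitable power of it will be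
  -- refined to an idempotent with the same property.
  set y := x - c
  have hφy : φ y = 0 := by simp [y, hc]
  have hψy : ψ y ≠ 0 := by
    rw [map_sub, hc', sub_ne_zero]
    exact Ne.symm hne
  set J := (IsLocalRing.maximalIdeal ℤ_[p]).map (algebraMap ℤ_[p] A)
  have hJ : ∀ χ : A →+* k, ∀ z ∈ J, χ z = 0 := by
    intro χ
    change J ≤ RingHom.ker χ
    rw [Ideal.map_le_iff_le_comap, PadicInt.maximalIdeal_eq_span_p, Ideal.span_singleton_le_iff_mem]
    simp [RingHom.mem_ker, hp]
  have : Finite (ℤ_[p] ⧸ IsLocalRing.maximalIdeal ℤ_[p]) :=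
    Finite.of_equiv _ (PadicInt.residueField (p := p)).symm.toEquiv
  have : Module.Finite (ℤ_[p] ⧸ IsLocalRing.maximalIdeal ℤ_[p]) (A ⧸ J) := by
    have : Module.Finite ℤ_[p] (A ⧸ J) := inferInstance
    exact Module.Finite.of_restrictScalars_finite ℤ_[p] _ _
  have : Finite (A ⧸ J) := Module.finite_of_finite (ℤ_[p] ⧸ IsLocalRing.maximalIdeal ℤ_[p])
  -- `A ⧸ J` is a finite ring, so a power of `y` is idempotent there. Both homomorphisms kill `J`,
  -- hence a lift `f` of it has `φ f = 0` and `ψ f = 1`.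
  obtain ⟨n, hn, hi⟩ := exists_isIdempotentElem_pow (Ideal.Quotient.mk J y)
  have hi' : y ^ n * y ^ n - y ^ n ∈ J := by
    rw [← Ideal.Quotient.eq, map_mul, map_pow]
    exact hi
  obtain ⟨f, hf, hfy⟩ := exists_isIdempotentElem_sub_mem (R := ℤ_[p]) _ hi'
  have hφf : φ f = 0 := by
    have := hJ φ _ hfy
    rwa [map_sub, map_pow, hφy, zero_pow hn, sub_zero] at this
  have hψf : ψ f = 1 := by
    have h1 := hJ ψ _ hfy
    have h2 : ψ f * ψ f = ψ f := by rw [← map_mul, hf.eq]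
    rw [map_sub, map_pow, sub_eq_zero] at h1
    exact mul_right_cancel₀ (h1 ▸ pow_ne_zero n hψy : ψ f ≠ 0) (by rw [h2, one_mul])
  have hee := he.1.eq
  have hff := hf.eq
  -- `f` would split `e` into two parts, of which `ψ` maps the first to 1 and `φ` maps the second to
  -- 1.
  rcases he.2.2 (e * f) (e * (1 - f)) (he.1.mul hf) (he.1.mul hf.one_sub)
    (by linear_combination (-e * e) * hff) (by linear_combination (-e * e) * hff)
    (by ring) with h0 | h0
  · have := congr_arg ψ h0
    simp [hψ, hψf] at this
  · have := congr_arg φ h0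
    simp [hφ, hφf] at this

/-- In a Noetherian ring there is a primitive idempotent not killed by a given homomorphism to a
domain. -/
theorem exists_isPrimitiveIdempotent_map_eq_one {R S : Type*} [CommRing R] [IsNoetherianRing R]
    [CommRing S] [IsDomain S] (φ : R →+* S) : ∃ b, IsPrimitiveIdempotent b ∧ φ b = 1 := by
  -- Larger ideals `(1 - b)` belong to smaller idempotents, so the chain condition provides a
  -- minimal `b` with `φ b = 1`.
  obtain ⟨I, ⟨b, hb, hφ, rfl⟩, hmax⟩ := set_has_maximal_iff_noetherian.2 ‹IsNoetherianRing R›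
    {I : Ideal R | ∃ b, IsIdempotentElem b ∧ φ b = 1 ∧ I = Ideal.span {1 - b}}
    ⟨_, 1, IsIdempotentElem.one, map_one φ, rfl⟩
  have key : ∀ f f' : R, IsIdempotentElem f → f * f' = 0 → b = f + f' → φ f = 1 → f' = 0 := by
    intro f f' hf h0 hbf h1
    have hle : Ideal.span {1 - b} ≤ Ideal.span {1 - f} := by
      rw [Ideal.span_singleton_le_iff_mem, Ideal.mem_span_singleton]
      refine ⟨1 - b, ?_⟩
      have := hf.eq
      rw [hbf]
      linear_combination -this - h0
    have := hmax _ ⟨f, hf, h1, rfl⟩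
    rw [lt_iff_le_not_ge, not_and_not_right] at this
    have hm := this hle (Ideal.mem_span_singleton_self (1 - f))
    obtain ⟨r, hr⟩ := Ideal.mem_span_singleton.1 hm
    have h2 : b * (1 - f) = 0 := by
      rw [hr]
      linear_combination (-r) * hb.eq
    rw [hbf] at h2
    linear_combination h2 + hf.eq + h0
  refine ⟨b, ⟨hb, ?_, fun f f' hf hf' h0 h0' hbf => ?_⟩, hφ⟩
  · rintro rfl
    simp at hφ
  -- In a domain one of the two orthogonal images, whose sum is 1, must vanish. Minimality then
  -- forces the summand with image 0 to be 0.
  · have h1 : φ f * φ f' = 0 := by rw [← map_mul, h0, map_zero]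
    have h2 : φ f + φ f' = 1 := by rw [← map_add, ← hbf, hφ]
    rcases mul_eq_zero.1 h1 with h3 | h3
    · exact Or.inl (key f' f hf' h0' (by rw [hbf, add_comm]) (by simpa [h3] using h2))
    · exact Or.inr (key f f' hf h0 hbf (by simpa [h3] using h2))

end Idempotents

/-! ### Sums invariant under a permutation of `p`-power order. -/

section FixedPoints

open Classical in
/-- In characteristic `p`, a sum over a finite set which is invariant under a permutation of
`p`-power order is the sum over the fixed points. -/
theorem sum_eq_sum_fixed {p : ℕ} [Fact p.Prime] {X R : Type*} [Fintype X] [Ring R]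
    (hp : (p : R) = 0) {n : ℕ} (σ : Equiv.Perm X) (hσ : σ ^ p ^ n = 1) (f : X → R)
    (hf : ∀ x, f (σ x) = f x) : ∑ x, f x = ∑ x with σ x = x, f x := by
  have hP : IsPGroup p (Subgroup.zpowers σ) := by
    rintro ⟨_, i, rfl⟩
    refine ⟨n, Subtype.ext ?_⟩
    change (σ ^ i) ^ p ^ n = 1
    rw [← zpow_natCast, zpow_comm, zpow_natCast, hσ, one_zpow]
  have hfix : ∀ x, (∀ i : ℤ, (σ ^ i) x = x) ↔ σ x = x :=
    fun x => ⟨fun h => by simpa using h 1, fun h i =>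
      Equiv.Perm.zpow_apply_eq_self_of_apply_eq_self h i⟩
  have hf' : ∀ (i : ℤ) x, f ((σ ^ i) x) = f x := by
    intro i
    induction i with
    | zero => simp
    | succ i ih => intro x; rw [zpow_add_one, Equiv.Perm.mul_apply, ih, hf]
    | pred i ih => intro x; rw [zpow_sub_one, Equiv.Perm.mul_apply, ih, ← hf]; simp
  -- Each level set of `f` is stable under the `p`-group generated by `σ`, so modulo `p` it has as
  -- many elements as fixed points. Grouping both sums by the values of `f` then suffices.
  have hcard : ∀ c : R, (((Finset.univ.filter fun x => f x = c).card : ℕ) : R) =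
      ((Finset.univ.filter fun x => σ x = x).filter fun x => f x = c).card := by
    intro c
    let Y : SubMulAction (Subgroup.zpowers σ) X :=
      { carrier := {x | f x = c}
        smul_mem' := by
          rintro ⟨_, i, rfl⟩ x hx
          exact (hf' i x).trans hx }
    have h1 := hP.card_modEq_card_fixedPoints Y
    have h2 : Nat.card Y = (Finset.univ.filter fun x => f x = c).card := by
      rw [← Fintype.card_subtype, ← Nat.card_eq_fintype_card]
      rfl
    have h3 : Nat.card (MulAction.fixedPoints (Subgroup.zpowers σ) Y) =
        ((Finset.univ.filter fun x => σ x = x).filter fun x => f x = c).card := by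
      rw [Finset.filter_filter, ← Fintype.card_subtype, ← Nat.card_eq_fintype_card]
      refine Nat.card_congr
        { toFun := fun y => ⟨y.1.1, (hfix _).1 fun i =>
            congr_arg Subtype.val (y.2 ⟨σ ^ i, i, rfl⟩), y.1.2⟩
          invFun := fun x => ⟨⟨x.1, x.2.2⟩, by
            rintro ⟨_, i, rfl⟩
            exact Subtype.ext ((hfix _).2 x.2.1 i)⟩
          left_inv := fun _ => rfl
          right_inv := fun _ => rfl }
    rw [h2, h3] at h1
    have hdvd := (Nat.modEq_iff_dvd.1 h1)
    obtain ⟨d, hd⟩ := hdvd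
    have := congr_arg (Int.cast : ℤ → R) hd
    push_cast at this
    rw [hp, zero_mul, sub_eq_zero] at this
    exact this.symm
  have hs : ∀ s : Finset X, ∑ x ∈ s, f x =
      ∑ c ∈ Finset.univ.image f, ((s.filter fun x => f x = c).card : R) * c := by
    intro s
    rw [← Finset.sum_fiberwise_of_maps_to (s := s) (t := Finset.univ.image f) (g := f)
      (fun x _ => Finset.mem_image_of_mem _ (Finset.mem_univ x))]
    refine Finset.sum_congr rfl fun c _ => ?_
    rw [Finset.sum_congr rfl (fun x hx => (Finset.mem_filter.1 hx).2), Finset.sum_const,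
      nsmul_eq_mul]
  rw [hs, hs]
  exact Finset.sum_congr rfl fun c _ => by rw [hcard]

end FixedPoints

/-! ### Traces of endomorphisms of finite order, modulo `𝔭`. -/

section Trace

/-- Splitting off an eigenline and passing to the quotient triangularises `T`, so `Λ` collects the
eigenvalues and one `Λ` serves all powers at once. When `T` has finite order, the first condition
says that they are roots of unity. -/
theorem exists_multiset_trace_pow {L : Type u} [Field L] [IsAlgClosed L] (n : ℕ) :
    ∀ (V : Type v) [AddCommGroup V] [Module L V] [Module.Finite L V] (T : Module.End L V),
      Module.finrank L V = n → ∃ Λ : Multiset L,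
        (∀ μ ∈ Λ, ∀ M, T ^ M = 1 → μ ^ M = 1) ∧
        ∀ j, LinearMap.trace L V (T ^ j) = (Λ.map (· ^ j)).sum := by
  induction n with
  | zero =>
    intro V _ _ _ T hV
    have := Module.finrank_zero_iff.1 hV
    refine ⟨0, by simp, fun j => ?_⟩
    rw [Subsingleton.elim (T ^ j) 0]
    simp
  | succ n ih =>
    intro V _ _ _ T hV
    have : Nontrivial V := Module.nontrivial_of_finrank_pos (R := L) (by omega)
    obtain ⟨μ, hμ⟩ := Module.End.exists_eigenvalue T
    obtain ⟨x, hx⟩ := hμ.exists_hasEigenvector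
    have hTx : T x = μ • x := hx.apply_eq_smul
    have hx0 : x ≠ 0 := hx.2
    let N := Submodule.span L {x}
    have hN : N ≤ N.comap T := by
      rw [Submodule.span_singleton_le_iff_mem, Submodule.mem_comap, hTx]
      exact N.smul_mem _ (Submodule.mem_span_singleton_self x)
    let T' : Module.End L (V ⧸ N) := N.mapQ N T hN
    have hpow : ∀ j (m : V), T' ^ j • N.mkQ m = N.mkQ ((T ^ j) m) := by
      intro j
      induction j with
      | zero => intro m; rfl
      | succ j ihj =>
        intro m
        rw [pow_succ, mul_smul]
        exact ihj (T m)
    have hpowx : ∀ j, (T ^ j) x = μ ^ j • x := by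
      intro j
      induction j with
      | zero => simp
      | succ j ihj => rw [pow_succ, Module.End.mul_apply, hTx, map_smul, ihj, smul_smul, pow_succ']
    have hfr : Module.finrank L (V ⧸ N) = n := by
      have h1 := N.finrank_quotient_add_finrank
      have h2 : Module.finrank L N = 1 := finrank_span_singleton hx0
      omega
    obtain ⟨Λ, h1, h2⟩ := ih (V ⧸ N) T' hfr
    refine ⟨μ ::ₘ Λ, fun ν hν M hM => ?_, fun j => ?_⟩
    · rcases Multiset.mem_cons.1 hν with rfl | hν
      · have := hpowx M
        rw [hM, Module.End.one_apply] at this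
        exact smul_left_injective L hx0 (by simpa using this.symm)
      · refine h1 ν hν M (LinearMap.ext fun m => ?_)
        obtain ⟨m, rfl⟩ := N.mkQ_surjective m
        refine (hpow M m).trans ?_
        rw [hM]
        rfl
    · rw [Multiset.map_cons, Multiset.sum_cons, ← h2]
      have := trace_exact (i := LinearMap.toSpanSingleton L V x) (q := N.mkQ)
        (f := μ ^ j • LinearMap.id) (g := T ^ j) (h := T' ^ j)
        (by
          intro a b hab
          exact smul_left_injective L hx0 (by simpa using hab))
        (by
          intro y
          rw [Submodule.mkQ_apply, Submodule.Quotient.mk_eq_zero, Submodule.mem_span_singleton]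
          rfl)
        N.mkQ_surjective
        (by
          intro m
          simp [hpowx, smul_smul, mul_comm])
        (fun m => (hpow j m).symm)
      rw [this]
      simp

variable {K : Type u} [Field K] {O : Type*} [CommRing O] [Algebra O K]
  {V : Type*} [AddCommGroup V] [Module K V] [Module.Finite K V]

/-- The traces of the powers of an endomorphism of finite order are integral, and the traces of `T`
and of its `p'`-part are congruent modulo `p`. -/
theorem exists_trace_sub_trace_pow_mem [IsIntegrallyClosedIn O K] (𝔭 : Ideal O) [h𝔭 : 𝔭.IsMaximal]
    {p : ℕ} (hp : (p : O) ∈ 𝔭) {n m d : ℕ} (hpp : p.Prime) (hm : m ≠ 0) (T : Module.End K V)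
    (hT : T ^ (p ^ n * m) = 1) :
    ∃ a b : O, algebraMap O K a = LinearMap.trace K V T ∧
      algebraMap O K b = LinearMap.trace K V (T ^ (1 + m * d)) ∧ a - b ∈ 𝔭 := by
  let L := AlgebraicClosure K
  obtain ⟨Λ, h1, h2⟩ := exists_multiset_trace_pow (L := L) _ (L ⊗[K] V) (T.baseChange L) rfl
  have hpow : ∀ j, T.baseChange L ^ j = (T ^ j).baseChange L := fun j =>
    ((Module.End.baseChangeHom K L V).map_pow T j).symm
  have hone : T.baseChange L ^ (p ^ n * m) = 1 := by
    rw [hpow, hT]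
    exact LinearMap.baseChange_id
  have htr : ∀ j, algebraMap K L (LinearMap.trace K V (T ^ j)) = (Λ.map (· ^ j)).sum := fun j => by
    rw [← h2, hpow, LinearMap.trace_baseChange]
  have hM : 0 < p ^ n * m := Nat.mul_pos (pow_pos hpp.pos n) (Nat.pos_of_ne_zero hm)
  have hint : ∀ μ ∈ Λ, IsIntegral O μ := fun μ hμ => by
    refine IsIntegral.of_pow hM ?_
    rw [h1 μ hμ _ hone]
    exact isIntegral_one
  have hinj : Function.Injective (algebraMap O L) := by
    rw [IsScalarTower.algebraMap_eq O K L, RingHom.coe_comp]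
    exact (algebraMap K L).injective.comp (IsIntegralClosure.algebraMap_injective O O K)
  -- The trace lies in `K` and is a sum of roots of unity, so it is integral over `O`, which is
  -- integrally closed in `K`.
  have hex : ∀ j, ∃ a : O, algebraMap O K a = LinearMap.trace K V (T ^ j) := fun j => by
    refine IsIntegrallyClosedIn.algebraMap_eq_of_integral ?_
    rw [← isIntegral_algebraMap_iff (algebraMap K L).injective, htr]
    exact IsIntegral.multiset_sum fun x hx => by
      obtain ⟨μ, hμ, rfl⟩ := Multiset.mem_map.1 hx
      exact (hint μ hμ).pow j
  obtain ⟨a, ha⟩ := hex 1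
  obtain ⟨b, hb⟩ := hex (1 + m * d)
  refine ⟨a, b, by rw [ha, pow_one], hb, ?_⟩
  -- The eigenvalues need not lie in `K`, so the congruence is checked one eigenvalue at a time
  -- modulo a prime `Q` over `𝔭`.
  obtain ⟨Q, hQ, hQ'⟩ := Ideal.exists_ideal_over_maximal_of_isIntegral
    (S := integralClosure O L) 𝔭 (by
      rw [(RingHom.injective_iff_ker_eq_bot (algebraMap O (integralClosure O L))).1]
      · exact bot_le
      · intro x y hxy
        exact hinj (congr_arg Subtype.val hxy))
  rw [← hQ', Ideal.mem_comap]
  have hpQ : (p : integralClosure O L) ∈ Q := by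
    rw [← hQ', Ideal.mem_comap] at hp
    simpa using hp
  -- The factor `μ ^ (m * d)` is a root of unity of `p`-power order, and `(1 - x) ^ p ^ n = 1 - x ^
  -- p ^ n` in characteristic `p` makes it 1 modulo `Q`. This works for every `d`; the choice for
  -- which the power is the `p'`-part is made later.
  have hmem : ∀ μ ∈ Λ, ∃ q ∈ Q, (q : L) = μ - μ ^ (1 + m * d) := by
    intro μ hμ
    let ν : integralClosure O L := ⟨μ, hint μ hμ⟩
    refine ⟨ν - ν ^ (1 + m * d), ?_, rfl⟩
    have hν : (ν ^ (m * d)) ^ p ^ n = 1 := by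
      refine Subtype.ext ?_
      change (μ ^ (m * d)) ^ p ^ n = 1
      rw [← pow_mul, show m * d * p ^ n = p ^ n * m * d by ring, pow_mul, h1 μ hμ _ hone, one_pow]
    have h3 : (1 - ν ^ (m * d)) ^ p ^ n ∈ Q := by
      rw [← Ideal.Quotient.eq_zero_iff_mem]
      have : CharP (integralClosure O L ⧸ Q) p := by
        refine (CharP.charP_iff_prime_eq_zero hpp).2 ?_
        rw [← map_natCast (Ideal.Quotient.mk Q)]
        exact Ideal.Quotient.eq_zero_iff_mem.2 hpQ
      have : Fact p.Prime := ⟨hpp⟩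
      rw [map_pow, map_sub, sub_pow_char_pow, ← map_pow, ← map_pow, hν, one_pow, sub_self]
    have h4 := hQ.isPrime.mem_of_pow_mem _ h3
    have : ν - ν ^ (1 + m * d) = ν * (1 - ν ^ (m * d)) := by ring
    rw [this]
    exact Q.mul_mem_left _ h4
  choose! q hq hq' using hmem
  have hsum : algebraMap O (integralClosure O L) (a - b) = (Λ.map q).sum := by
    refine Subtype.ext ?_
    have e1 : (((Λ.map q).sum : integralClosure O L) : L) =
        (Λ.map fun μ => μ - μ ^ (1 + m * d)).sum := by
      rw [← Subalgebra.coe_val, map_multiset_sum, Multiset.map_map]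
      exact congr_arg Multiset.sum (Multiset.map_congr rfl fun μ hμ => hq' μ hμ)
    rw [e1, Multiset.sum_map_sub, ← htr]
    change algebraMap O L (a - b) = _
    rw [map_sub, IsScalarTower.algebraMap_apply O K L a, ha, IsScalarTower.algebraMap_apply O K L b,
      hb, htr 1]
    simp
  rw [hsum]
  exact multiset_sum_mem _ fun x hx => by
    obtain ⟨μ, hμ, rfl⟩ := Multiset.mem_map.1 hx
    exact hq μ hμ

end Trace

/-! ### Centres of group algebras and the Brauer homomorphism. -/

section GroupAlgebra

variable {H : Type*} [Group H] {R : Type*} [CommRing R]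

/-- The centre of the group algebra consists of the class functions. -/
theorem MonoidAlgebra.mem_center_iff_coeff {x : MonoidAlgebra R H} :
    x ∈ Subalgebra.center R (MonoidAlgebra R H) ↔
      ∀ a b : H, x.coeff (b * a * b⁻¹) = x.coeff a := by
  rw [Subalgebra.mem_center_iff]
  constructor
  · intro h a b
    have := congr_arg (fun z : MonoidAlgebra R H => z.coeff (b * a)) (h (MonoidAlgebra.single b 1))
    simpa using this.symm
  · intro h y
    induction y using MonoidAlgebra.induction_linear with
    | zero => simp
    | add y z hy hz => rw [add_mul, mul_add, hy, hz]
    | single b r =>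
      ext a
      have := h (b⁻¹ * a) b
      rw [mul_inv_cancel_left] at this
      simp [this, mul_comm]

/-- The element `∑ f(a) a` of the group algebra. -/
def MonoidAlgebra.ofFun {H R : Type*} [CommRing R] [Finite H] (f : H → R) : MonoidAlgebra R H :=
  .ofCoeff (Finsupp.equivFunOnFinite.symm f)

@[simp]
theorem MonoidAlgebra.coeff_ofFun {H R : Type*} [CommRing R] [Finite H] (f : H → R) (a : H) :
    (MonoidAlgebra.ofFun f).coeff a = f a := rfl

theorem MonoidAlgebra.coeff_mul_eq_sum [Fintype H] (x y : MonoidAlgebra R H) (l : H) :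
    (x * y).coeff l = ∑ a, x.coeff a * y.coeff (a⁻¹ * l) := by
  classical
  rw [MonoidAlgebra.coeff_mul_antidiag x y l (Finset.univ.image fun a => (a, a⁻¹ * l))]
  · rw [Finset.sum_image]
    intro a _ b _ h
    exact (Prod.ext_iff.1 h).1
  · rintro ⟨a, b⟩
    simp only [Finset.mem_image, Finset.mem_univ, true_and, Prod.mk.injEq, exists_eq_left]
    rw [inv_mul_eq_iff_eq_mul, eq_comm]

theorem MonoidAlgebra.module_finite {H R : Type*} [CommRing R] [Finite H] :
    Module.Finite R (MonoidAlgebra R H) :=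
  Module.Finite.equiv (MonoidAlgebra.coeffLinearEquiv R).symm

/-- An `R`-linear map on the centre maps elements with coefficients in an ideal into that ideal. -/
theorem map_mem_of_coeff_mem [Finite H]
    (φ : Subalgebra.center R (MonoidAlgebra R H) →ₗ[R] R) (I : Ideal R)
    (x : Subalgebra.center R (MonoidAlgebra R H)) (hx : ∀ a, (x : MonoidAlgebra R H).coeff a ∈ I) :
    φ x ∈ I := by
  classical
  have := Fintype.ofFinite H
  let c : ConjClasses H → Subalgebra.center R (MonoidAlgebra R H) := fun C =>
    ⟨.ofFun fun a => if ConjClasses.mk a = C then 1 else 0,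
      MonoidAlgebra.mem_center_iff_coeff.2 fun a b => by
        have : ConjClasses.mk (b * a * b⁻¹) = ConjClasses.mk a :=
          ConjClasses.mk_eq_mk_iff_isConj.2 (isConj_iff.2 ⟨b, rfl⟩).symm
        simp [this]⟩
  have hcl : ∀ a b, ConjClasses.mk a = ConjClasses.mk b →
      (x : MonoidAlgebra R H).coeff a = (x : MonoidAlgebra R H).coeff b := fun a b h => by
    obtain ⟨g, rfl⟩ := isConj_iff.1 (ConjClasses.mk_eq_mk_iff_isConj.1 h)
    exact (MonoidAlgebra.mem_center_iff_coeff.1 x.2 a g).symm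
  -- The class sums `c C` lie in the centre and `x` is a combination of them with its own
  -- coefficients, so linearity of `φ` is enough.
  have hsum : x = ∑ C : ConjClasses H, (x : MonoidAlgebra R H).coeff C.out • c C := by
    refine Subtype.ext ?_
    rw [AddSubmonoidClass.coe_finsetSum]
    ext a
    rw [MonoidAlgebra.coeff_sum, Finsupp.finsetSum_apply, Finset.sum_eq_single (ConjClasses.mk a)]
    · have h1 : (x : MonoidAlgebra R H).coeff (ConjClasses.mk a).out =
          (x : MonoidAlgebra R H).coeff a := hcl _ _ (Quotient.out_eq _)
      simp [c, h1]
    · intro C _ hC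
      simp [c, hC.symm]
    · simp
  rw [hsum, map_sum]
  exact I.sum_mem fun C _ => by
    rw [map_smul, smul_eq_mul]
    exact I.mul_mem_right _ (hx _)

/-- Restriction of class functions along an injective homomorphism. -/
def truncate {L : Type*} [Group L] (ι : L →* H) (hι : Function.Injective ι) :
    Subalgebra.center R (MonoidAlgebra R H) →ₗ[R] Subalgebra.center R (MonoidAlgebra R L) where
  toFun x := ⟨.ofCoeff ((x : MonoidAlgebra R H).coeff.comapDomain ι hι.injOn),
    MonoidAlgebra.mem_center_iff_coeff.2 fun a b => by
      simpa using MonoidAlgebra.mem_center_iff_coeff.1 x.2 (ι a) (ι b)⟩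
  map_add' x y := by
    ext a
    simp
  map_smul' r x := by
    ext a
    simp

/-- Truncation to the centralizer of an element of `p`-power order is multiplicative modulo `p`. -/
theorem coeff_truncate_mul_sub_mem {L : Type*} [Group L] [Finite H] (ι : L →* H)
    (hι : Function.Injective ι) {p : ℕ} [Fact p.Prime] (I : Ideal R) (hp : (p : R) ∈ I) (w : H)
    {n : ℕ} (hw : w ^ p ^ n = 1) (hwι : ∀ h : H, h ∈ ι.range ↔ Commute w h)
    (x y : Subalgebra.center R (MonoidAlgebra R H)) (l : L) :
    (truncate ι hι (x * y) - truncate ι hι x * truncate ι hι y : MonoidAlgebra R L).coeff l ∈ I := by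
  classical
  have := Fintype.ofFinite H
  have := Fintype.ofInjective ι hι
  let σ : Equiv.Perm H := MulAut.toPerm H (MulAut.conj w)
  have hσ : ∀ a, σ a = w * a * w⁻¹ := fun a => rfl
  have hσn : σ ^ p ^ n = 1 := by
    rw [← map_pow, ← map_pow, hw, map_one, map_one]
  have hl : Commute w (ι l) := (hwι _).1 ⟨l, rfl⟩
  have hmk : (p : R ⧸ I) = 0 := by
    rw [← map_natCast (Ideal.Quotient.mk I)]
    exact Ideal.Quotient.eq_zero_iff_mem.2 hp
  -- The coefficient of `x * y` at `ι l` is a sum over `a` in `H`. Since `w` commutes with `ι l`,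
  -- conjugation by `w` preserves the summands, so modulo `I` only the `a` commuting with `w`
  -- remain, which form the image of `L`.
  have key := sum_eq_sum_fixed hmk σ hσn (fun a => Ideal.Quotient.mk I
    ((x : MonoidAlgebra R H).coeff a * (y : MonoidAlgebra R H).coeff (a⁻¹ * ι l))) fun a => by
      have h1 := MonoidAlgebra.mem_center_iff_coeff.1 x.2 a w
      have h2 := MonoidAlgebra.mem_center_iff_coeff.1 y.2 (a⁻¹ * ι l) w
      have h3 : w * (a⁻¹ * ι l) * w⁻¹ = (w * a * w⁻¹)⁻¹ * ι l := by
        have := hl.inv_left.eq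
        simp only [mul_inv_rev, inv_inv, mul_assoc]
        rw [this]
      rw [hσ, h1, ← h3, h2]
  have hfix : ∑ a with σ a = a, Ideal.Quotient.mk I
      ((x : MonoidAlgebra R H).coeff a * (y : MonoidAlgebra R H).coeff (a⁻¹ * ι l)) =
      ∑ b : L, Ideal.Quotient.mk I
      ((x : MonoidAlgebra R H).coeff (ι b) * (y : MonoidAlgebra R H).coeff (ι (b⁻¹ * l))) := by
    symm
    refine Finset.sum_bij (fun b _ => ι b) ?_ (fun _ _ _ _ h => hι h) ?_ ?_
    · intro b _
      have : Commute w (ι b) := (hwι _).1 ⟨b, rfl⟩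
      simp [hσ, this.eq]
    · intro a ha
      have h1 : w * a * w⁻¹ = a := (Finset.mem_filter.1 ha).2
      obtain ⟨b, hb⟩ := (hwι a).2 (mul_inv_eq_iff_eq_mul.1 h1)
      exact ⟨b, Finset.mem_univ _, hb⟩
    · intro b _
      rw [map_mul ι, map_inv]
  rw [← Ideal.Quotient.eq_zero_iff_mem]
  have hsub : (truncate ι hι (x * y) - truncate ι hι x * truncate ι hι y : MonoidAlgebra R L).coeff l
      = ∑ a, ((x : MonoidAlgebra R H).coeff a * (y : MonoidAlgebra R H).coeff (a⁻¹ * ι l)) -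
        ∑ b : L, ((x : MonoidAlgebra R H).coeff (ι b) *
          (y : MonoidAlgebra R H).coeff (ι (b⁻¹ * l))) := by
    have e1 := MonoidAlgebra.coeff_mul_eq_sum (x : MonoidAlgebra R H) y (ι l)
    have e2 := MonoidAlgebra.coeff_mul_eq_sum (truncate ι hι x : MonoidAlgebra R L)
      (truncate ι hι y) l
    rw [MonoidAlgebra.coeff_sub, Finsupp.sub_apply, e2]
    congr 1
  rw [hsub, map_sub, map_sum, map_sum, key, hfix, sub_self]

end GroupAlgebra

/-! ### Central characters and their integrality. -/

section CentralCharacter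

variable {H : Type*} [Group H] {K : Type v} [Field K]

/-- The scalar by which a central element `x` acts on a representation affording `χ`. -/
def omega (χ : H → K) (x : MonoidAlgebra K H) : K := (χ 1)⁻¹ * ∑ᶠ a, χ a * x.coeff a

variable {W : Type*} [AddCommGroup W] [Module K W] [Module.Finite K W] {ρ : Representation K H W}

theorem Representation.IsIrreducible.nontrivial {W : Type*} [AddCommGroup W] [Module K W]
    {ρ : Representation K H W} (hρ : ρ.IsIrreducible) : Nontrivial W :=
  have := hρ
  IsSimpleModule.nontrivial (MonoidAlgebra K H) ρ.asModule

/-- All endomorphisms of the representation are scalars. -/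
def IsSplitRep (ρ : Representation K H W) : Prop :=
  ∀ f : W →ₗ[K] W, (∀ h : H, f ∘ₗ ρ h = ρ h ∘ₗ f) → ∃ c : K, f = c • LinearMap.id

/-- Schur's lemma in its split form makes a central element act as a scalar; comparing traces
identifies the scalar, the dimension being invertible in characteristic 0. -/
theorem asAlgebraHom_eq_omega_smul [Finite H] [CharZero K] (hρ : ρ.IsIrreducible)
    (hs : IsSplitRep ρ) {x : MonoidAlgebra K H}
    (hx : x ∈ Subalgebra.center K (MonoidAlgebra K H)) :
    ρ.asAlgebraHom x = algebraMap K (Module.End K W) (omega ρ.character x) := by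
  classical
  have := Fintype.ofFinite H
  have := hρ.nontrivial
  obtain ⟨c, hc⟩ := hs (ρ.asAlgebraHom x) fun h => by
    have := Subalgebra.mem_center_iff.1 hx (MonoidAlgebra.single h 1)
    have := congr_arg ρ.asAlgebraHom this
    rw [map_mul, map_mul, Representation.asAlgebraHom_single_one] at this
    exact this.symm
  have htr : LinearMap.trace K W (ρ.asAlgebraHom x) = ∑ a, ρ.character a * x.coeff a := by
    rw [Representation.asAlgebraHom_def, MonoidAlgebra.lift_apply,
      Finsupp.sum_fintype _ _ (by simp), map_sum]
    refine Finset.sum_congr rfl fun a _ => ?_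
    rw [map_smul, smul_eq_mul, mul_comm]
    rfl
  have h1 : ρ.character 1 = Module.finrank K W := Representation.char_one ρ
  have h0 : (Module.finrank K W : K) ≠ 0 := Nat.cast_ne_zero.2 Module.finrank_pos.ne'
  have : omega ρ.character x = c := by
    rw [omega, finsum_eq_sum_of_fintype, ← htr, hc, h1, map_smul, LinearMap.trace_id, smul_eq_mul,
      mul_comm c, inv_mul_cancel_left₀ h0]
  rw [this, hc]
  rfl

variable {O : Type*} [CommRing O] [Algebra O K]

theorem coeff_toKAlg (x : MonoidAlgebra O H) (a : H) :
    (toKAlg K H x).coeff a = algebraMap O K (x.coeff a) := by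
  simp [toKAlg]

theorem toKAlg_mem_center {x : MonoidAlgebra O H}
    (hx : x ∈ Subalgebra.center O (MonoidAlgebra O H)) :
    toKAlg K H x ∈ Subalgebra.center K (MonoidAlgebra K H) := by
  rw [MonoidAlgebra.mem_center_iff_coeff] at hx ⊢
  intro a b
  rw [coeff_toKAlg, coeff_toKAlg, hx]

/-- The central character, as a homomorphism on the centre of the integral group algebra. -/
theorem exists_algHom_eq_omega [Finite H] [CharZero K] (hρ : ρ.IsIrreducible)
    (hs : IsSplitRep ρ) : ∃ Ω : Subalgebra.center O (MonoidAlgebra O H) →ₐ[O] K,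
      ∀ x, Ω x = omega ρ.character (toKAlg K H (x : MonoidAlgebra O H)) := by
  have := hρ.nontrivial
  have hinj : Function.Injective (algebraMap K (Module.End K W)) :=
    (algebraMap K (Module.End K W)).injective
  -- The laws of a homomorphism are verified after embedding `K` in the endomorphisms of `W`, where
  -- they are those of the representation.
  have hact : ∀ x ∈ Subalgebra.center O (MonoidAlgebra O H),
      algebraMap K (Module.End K W) (omega ρ.character (toKAlg K H x)) =
        ρ.asAlgebraHom (toKAlg K H x) := fun x hx =>
    (asAlgebraHom_eq_omega_smul hρ hs (toKAlg_mem_center hx)).symm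
  refine ⟨AlgHom.ofLinearMap
    { toFun := fun x => omega ρ.character (toKAlg K H (x : MonoidAlgebra O H))
      map_add' := fun x y => hinj ?_
      map_smul' := fun r x => hinj ?_ } (hinj ?_) (fun x y => hinj ?_), fun _ => rfl⟩
  · rw [map_add, hact _ x.2, hact _ y.2, hact _ (x + y).2, ← map_add, ← map_add]
    rfl
  · have : toKAlg K H (r • (x : MonoidAlgebra O H)) =
        algebraMap O K r • toKAlg K H (x : MonoidAlgebra O H) := by
      ext a
      simp [toKAlg, Algebra.smul_def]
    rw [RingHom.id_apply, Algebra.smul_def r (omega _ _), map_mul, hact _ x.2, hact _ (r • x).2,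
      ← Algebra.smul_def, ← map_smul, ← this]
    rfl
  · change algebraMap K (Module.End K W) (omega ρ.character (toKAlg K H (1 : MonoidAlgebra O H))) = _
    rw [hact _ (one_mem _), map_one, map_one, map_one]
  · change algebraMap K (Module.End K W) (omega ρ.character (toKAlg K H (x * y : MonoidAlgebra O H)))
      = algebraMap K (Module.End K W) (omega ρ.character (toKAlg K H (x : MonoidAlgebra O H)) *
        omega ρ.character (toKAlg K H (y : MonoidAlgebra O H)))
    rw [map_mul (algebraMap K _), hact _ x.2, hact _ y.2, hact _ (mul_mem x.2 y.2), ← map_mul,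
      ← map_mul]

/-- The central character of an absolutely irreducible representation takes integral values on the
centre of the integral group algebra. -/
theorem exists_centralCharacter [Finite H] [CharZero K] [IsIntegrallyClosedIn O K]
    (hρ : ρ.IsIrreducible) (hs : IsSplitRep ρ) :
    ∃ φ : Subalgebra.center O (MonoidAlgebra O H) →ₐ[O] O,
      ∀ x, algebraMap O K (φ x) = omega ρ.character (toKAlg K H (x : MonoidAlgebra O H)) := by
  obtain ⟨Ω, hΩ⟩ := exists_algHom_eq_omega (O := O) hρ hs
  have := MonoidAlgebra.module_finite (R := O) (H := H)
  -- Elements of the group algebra are integral because it is a finite `O`-module; so are their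
  -- images in `K`.
  have hint : ∀ x, ∃ y, algebraMap O K y = Ω x := fun x => by
    refine IsIntegrallyClosedIn.algebraMap_eq_of_integral (IsIntegral.map Ω ?_)
    rw [← isIntegral_algHom_iff (Subalgebra.val _) Subtype.val_injective]
    exact IsIntegral.of_finite O _
  have hO : Function.Injective (algebraMap O K) := IsIntegralClosure.algebraMap_injective O O K
  choose φ hφ using hint
  refine ⟨{ toFun := φ
            map_one' := hO (by rw [hφ, map_one, map_one])
            map_mul' := fun x y => hO (by rw [map_mul, hφ, hφ, hφ, map_mul])
            map_zero' := hO (by rw [hφ, map_zero, map_zero])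
            map_add' := fun x y => hO (by rw [map_add, hφ, hφ, hφ, map_add])
            commutes' := fun r => hO (by rw [hφ, AlgHom.commutes]; rfl) }, fun x => ?_⟩
  rw [← hΩ]
  exact hφ x

end CentralCharacter

/-! ### Subbundles and finite generation of the Grothendieck group. -/

namespace EqBundle

variable {G : Type u} {K : Type v} [Group G] [Field K]

/-- A subbundle: a family of subspaces of the fibres stable under the action. -/
structure Sub (V : EqBundle G K) where
  carrier : ∀ a : G, Submodule K (V.fib a)
  stable : ∀ (x : G) {a b : G} (h : SemiconjBy x a b), carrier a ≤ (carrier b).comap (V.act x h)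

namespace Sub

variable {V : EqBundle G K}

/-- A subbundle as an equivariant bundle. -/
def toBundle (N : V.Sub) : EqBundle G K where
  fib a := N.carrier a
  act x _ _ h := (V.act x h).restrict (N.stable x h)
  act_one h m := Subtype.ext (V.act_one h m)
  act_act hy hx h m := Subtype.ext (V.act_act hy hx h m)

/-- The quotient by a subbundle. -/
def quot (N : V.Sub) : EqBundle G K where
  fib a := V.fib a ⧸ N.carrier a
  act x a b h := (N.carrier a).mapQ (N.carrier b) (V.act x h) (N.stable x h)
  act_one {a} h m := by
    obtain ⟨m, rfl⟩ := (N.carrier a).mkQ_surjective m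
    exact congr_arg (N.carrier a).mkQ (V.act_one h m)
  act_act {x y a b c} hy hx h m := by
    obtain ⟨m, rfl⟩ := (N.carrier a).mkQ_surjective m
    exact congr_arg (N.carrier c).mkQ (V.act_act hy hx h m)

theorem cls_eq_add (N : V.Sub) : KG.cls V = KG.cls N.toBundle + KG.cls N.quot := by
  let i : Hom N.toBundle V := ⟨fun a => (N.carrier a).subtype, fun _ _ _ _ _ => rfl⟩
  let q : Hom V N.quot := ⟨fun a => (N.carrier a).mkQ, fun _ _ _ _ _ => rfl⟩
  exact KG.cls_exact (i := i) (q := q) fun a =>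
    ⟨Subtype.val_injective, LinearMap.exact_subtype_mkQ (N.carrier a),
      (N.carrier a).mkQ_surjective⟩

/-- The image of a subbundle. -/
def map {W : EqBundle G K} (N : V.Sub) (f : Hom V W) : W.Sub where
  carrier a := (N.carrier a).map (f.app a)
  stable x a b h := by
    rintro _ ⟨m, hm, rfl⟩
    exact ⟨V.act x h m, N.stable x h hm, f.comm x h m⟩

/-- The intersection of a subbundle with a kernel. -/
def infKer {W : EqBundle G K} (N : V.Sub) (f : Hom V W) : V.Sub where
  carrier a := N.carrier a ⊓ LinearMap.ker (f.app a)
  stable x a b h := by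
    rintro m ⟨hm, hm'⟩
    refine ⟨N.stable x h hm, ?_⟩
    change f.app b _ = 0
    rw [f.comm, LinearMap.mem_ker.1 hm', map_zero]

end Sub

theorem cls_eq_zero {V : EqBundle G K} (h : ∀ a, Subsingleton (V.fib a)) : KG.cls V = 0 := by
  rw [← KG.cls_zero (G := G) (K := K)]
  let f : Hom V (KG.zeroBundle G K) := ⟨fun _ => 0, fun _ _ _ _ _ => rfl⟩
  exact KG.cls_eq f fun a => ⟨fun _ _ _ => (h a).elim _ _, fun y => ⟨0, rfl⟩⟩

variable [Finite G]

/-- The total dimension of a bundle. -/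
def dim (V : EqBundle G K) : ℕ :=
  let := Fintype.ofFinite G
  ∑ a, Module.finrank K (V.fib a)

theorem dim_eq_zero {V : EqBundle G K} : V.dim = 0 ↔ ∀ a, Subsingleton (V.fib a) := by
  let := Fintype.ofFinite G
  rw [dim, Finset.sum_eq_zero_iff]
  exact ⟨fun h a => Module.finrank_zero_iff.1 (h a (Finset.mem_univ a)),
    fun h a _ => Module.finrank_zero_iff.2 (h a)⟩

theorem Sub.dim_quot_add_dim {V : EqBundle G K} (N : V.Sub) :
    N.quot.dim + N.toBundle.dim = V.dim := by
  rw [dim, dim, dim, ← Finset.sum_add_distrib]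
  exact Finset.sum_congr rfl fun a _ => (N.carrier a).finrank_quotient_add_finrank

theorem Sub.dim_eq_zero {V : EqBundle G K} (N : V.Sub) :
    N.toBundle.dim = 0 ↔ ∀ a, N.carrier a = ⊥ := by
  rw [EqBundle.dim_eq_zero]
  exact forall_congr' fun a => Submodule.subsingleton_iff_eq_bot

theorem Sub.carrier_eq_of_le {V : EqBundle G K} {N N' : V.Sub}
    (h : ∀ a, N.carrier a ≤ N'.carrier a) (hd : N'.toBundle.dim ≤ N.toBundle.dim) (a : G) :
    N.carrier a = N'.carrier a := by
  let := Fintype.ofFinite G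
  have hle : ∀ a ∈ Finset.univ, Module.finrank K (N.carrier a) ≤ Module.finrank K (N'.carrier a) :=
    fun a _ => Submodule.finrank_mono (h a)
  have := (Finset.sum_eq_sum_iff_of_le hle).1 (le_antisymm (Finset.sum_le_sum hle) hd) a
    (Finset.mem_univ a)
  exact Submodule.eq_of_le_of_finrank_eq (h a) this

/-- A non-zero bundle has a minimal non-zero subbundle. -/
theorem exists_minimal_sub {V : EqBundle G K} (hV : V.dim ≠ 0) :
    ∃ N : V.Sub, N.toBundle.dim ≠ 0 ∧
      ∀ N' : V.Sub, N'.toBundle.dim ≠ 0 → N.toBundle.dim ≤ N'.toBundle.dim := by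
  classical
  have hex : ∃ d, d ≠ 0 ∧ ∃ N : V.Sub, N.toBundle.dim = d := by
    let N : V.Sub := ⟨fun _ => ⊤, fun _ _ _ _ _ _ => trivial⟩
    refine ⟨_, fun h => hV ?_, N, rfl⟩
    rw [N.dim_eq_zero] at h
    rw [EqBundle.dim_eq_zero]
    exact fun a => (Submodule.subsingleton_iff K).1 (subsingleton_of_bot_eq_top (h a).symm)
  obtain ⟨h0, N, hN⟩ := Nat.find_spec hex
  refine ⟨N, hN ▸ h0, fun N' h' => ?_⟩
  rw [hN]
  exact Nat.find_min' hex ⟨h', N', rfl⟩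

/-- The classes of the quotients of a bundle lie in a finitely generated subgroup. -/
theorem exists_finset_cls_quotient_mem (n : ℕ) : ∀ V : EqBundle G K, V.dim = n →
    ∃ T : Finset (KG G K), ∀ (W : EqBundle G K) (f : Hom V W),
      (∀ a, Function.Surjective (f.app a)) → KG.cls W ∈ AddSubgroup.closure (T : Set (KG G K)) := by
  classical
  induction n using Nat.strong_induction_on with
  | _ n ih =>
  intro V hV
  by_cases h0 : V.dim = 0
  · refine ⟨∅, fun W f hf => ?_⟩
    rw [cls_eq_zero fun a => ?_]
    · exact zero_mem _
    · have := EqBundle.dim_eq_zero.1 h0 a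
      exact (hf a).subsingleton
  -- The image of `N` in `W` is isomorphic to `N` or zero, because `N` meets the kernel trivially or
  -- is contained in it. The quotient of `W` by this image is a quotient of `V` by `N`, of smaller
  -- dimension.
  · obtain ⟨N, hN0, hN⟩ := exists_minimal_sub h0
    have hd := N.dim_quot_add_dim
    obtain ⟨T, hT⟩ := ih N.quot.dim (by omega) N.quot rfl
    refine ⟨insert (KG.cls N.toBundle) T, fun W f hf => ?_⟩
    rw [(N.map f).cls_eq_add]
    refine add_mem ?_ (AddSubgroup.closure_mono (by simp) (hT (N.map f).quot
      ⟨fun a => (N.carrier a).mapQ ((N.map f).carrier a) (f.app a) (Submodule.le_comap_map _ _),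
        fun x a b h m => ?_⟩ fun a m => ?_))
    · by_cases hk : (N.infKer f).toBundle.dim = 0
      · refine AddSubgroup.subset_closure ?_
        let f' : Hom N.toBundle (N.map f).toBundle :=
          ⟨fun a => (f.app a).restrict fun m hm => ⟨m, hm, rfl⟩,
            fun x a b h m => Subtype.ext (f.comm x h m.1)⟩
        rw [← KG.cls_eq f' fun a => ⟨?_, ?_⟩]
        · simp
        · rw [← LinearMap.ker_eq_bot, LinearMap.ker_eq_bot']
          intro m hm
          have h1 : m.1 ∈ (N.infKer f).carrier a := ⟨m.2, congr_arg Subtype.val hm⟩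
          rw [((N.infKer f).dim_eq_zero.1 hk a)] at h1
          exact Subtype.ext h1
        · rintro ⟨_, m, hm, rfl⟩
          exact ⟨⟨m, hm⟩, rfl⟩
      · have heq := Sub.carrier_eq_of_le (N := N.infKer f) (N' := N) (fun a => inf_le_left)
          (hN _ hk)
        have hz : KG.cls (N.map f).toBundle = 0 := cls_eq_zero fun a => by
          refine Submodule.subsingleton_iff_eq_bot.2 ?_
          rw [eq_bot_iff]
          rintro _ ⟨m, hm, rfl⟩
          rw [SetLike.mem_coe, ← heq a] at hm
          exact hm.2
        rw [hz]
        exact zero_mem _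
    · obtain ⟨m, rfl⟩ := (N.carrier a).mkQ_surjective m
      exact congr_arg ((N.map f).carrier b).mkQ (f.comm x h m)
    · obtain ⟨m, rfl⟩ := ((N.map f).carrier a).mkQ_surjective m
      obtain ⟨m, rfl⟩ := hf a m
      exact ⟨(N.carrier a).mkQ m, rfl⟩

/-- The bundle freely generated by one element of the fibre over `h`. -/
def free (K : Type v) [Field K] (h : G) : EqBundle G K where
  fib a := {x : G // SemiconjBy x h a} → K
  act y a b hy := LinearMap.funLeft K K fun x : {x : G // SemiconjBy x h b} =>
    (⟨y⁻¹ * x, hy.inv_symm_left.mul_left x.2⟩ : {x : G // SemiconjBy x h a})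
  act_one {a} h m := by
    refine funext fun x => congr_arg m (Subtype.ext ?_)
    simp
  act_act {x y a b c} hy hx h m := by
    refine funext fun x => congr_arg m (Subtype.ext ?_)
    simp [mul_assoc]

/-- The morphism from the free bundle mapping the generator to `w`. -/
def ofFree (V : EqBundle G K) {h : G} (w : V.fib h) : Hom (free K h) V where
  app a :=
    let := Fintype.ofFinite {x : G // SemiconjBy x h a}
    Fintype.linearCombination K fun x : {x : G // SemiconjBy x h a} => V.act x.1 x.2 w
  comm y a b hy m := by
    let := Fintype.ofFinite {x : G // SemiconjBy x h a}
    let := Fintype.ofFinite {x : G // SemiconjBy x h b}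
    change ∑ x : {x : G // SemiconjBy x h b}, (free K h).act y hy m x • V.act x.1 x.2 w =
      V.act y hy (∑ x : {x : G // SemiconjBy x h a}, m x • V.act x.1 x.2 w)
    simp only [map_sum, map_smul]
    symm
    refine Fintype.sum_equiv
      { toFun := fun x => ⟨y * x, hy.mul_left x.2⟩
        invFun := fun x => ⟨y⁻¹ * x, hy.inv_symm_left.mul_left x.2⟩
        left_inv := fun x => by simp
        right_inv := fun x => by simp } _ _ fun x => ?_
    rw [V.act_act hy x.2 (hy.mul_left x.2)]
    congr 1
    refine congr_arg m (Subtype.ext ?_)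
    simp

theorem exists_ofFree_app_eq (V : EqBundle G K) {h : G} (w : V.fib h) :
    ∃ m, (ofFree V w).app h m = w := by
  classical
  let := Fintype.ofFinite {x : G // SemiconjBy x h h}
  refine ⟨(Pi.single ⟨1, SemiconjBy.one_left h⟩ 1 : {x : G // SemiconjBy x h h} → K), ?_⟩
  refine (Fintype.linearCombination_apply_single K _ _ _).trans ?_
  rw [one_smul, V.act_one]

end EqBundle

/-- Induction principle for the Grothendieck group. -/
theorem KG.induction_cls {G : Type u} {K : Type v} [Group G] [Field K] {motive : KG G K → Prop}
    (x : KG G K) (cls : ∀ V, motive (KG.cls V)) (neg : ∀ x, motive x → motive (-x))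
    (add : ∀ x y, motive x → motive y → motive (x + y)) : motive x := by
  obtain ⟨x, rfl⟩ := QuotientAddGroup.mk'_surjective (KGRel G K) x
  induction x using FreeAbelianGroup.induction_on with
  | zero =>
    have := add _ _ (cls (KG.zeroBundle G K)) (neg _ (cls (KG.zeroBundle G K)))
    rwa [add_neg_cancel] at this
  | of V => exact cls V
  | neg V hV => exact neg _ hV
  | add x y hx hy => exact add _ _ hx hy

open EqBundle in
/-- The Grothendieck group of equivariant bundles is finitely generated. -/
theorem KG.module_finite (G : Type u) (K : Type v) [Group G] [Finite G] [Field K] :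
    Module.Finite ℤ (KG G K) := by
  classical
  let := Fintype.ofFinite G
  -- Every non-zero bundle contains a non-zero quotient of one of the finitely many bundles `free K
  -- h`, so induction on the dimension expresses its class through these generators.
  choose T hT using fun h : G => exists_finset_cls_quotient_mem _ (free K h) rfl
  let S : Finset (KG G K) := Finset.univ.biUnion T
  have key : ∀ (n : ℕ) (V : EqBundle G K), V.dim = n →
      KG.cls V ∈ AddSubgroup.closure (S : Set (KG G K)) := by
    intro n
    induction n using Nat.strong_induction_on with
    | _ n ih =>
    intro V hV
    by_cases h0 : V.dim = 0
    · rw [cls_eq_zero (EqBundle.dim_eq_zero.1 h0)]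
      exact zero_mem _
    · have h1 := h0
      rw [EqBundle.dim_eq_zero, not_forall] at h1
      obtain ⟨h, hh⟩ := h1
      rw [not_subsingleton_iff_nontrivial] at hh
      obtain ⟨w, hw⟩ := exists_ne (0 : V.fib h)
      let F : (free K h).Sub := ⟨fun _ => ⊤, fun _ _ _ _ _ _ => trivial⟩
      let N := F.map (ofFree V w)
      have hN : N.toBundle.dim ≠ 0 := by
        rw [Ne, N.dim_eq_zero]
        intro hb
        obtain ⟨m, hm⟩ := exists_ofFree_app_eq V w
        have : w ∈ N.carrier h := ⟨m, trivial, hm⟩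
        rw [hb h] at this
        exact hw this
      have hd := N.dim_quot_add_dim
      rw [N.cls_eq_add]
      refine add_mem ?_ (ih N.quot.dim (by omega) N.quot rfl)
      refine AddSubgroup.closure_mono ?_ (hT h N.toBundle
        ⟨fun a => ((ofFree V w).app a).codRestrict _ fun m => ⟨m, trivial, rfl⟩,
          fun x a b k m => Subtype.ext ((ofFree V w).comm x k m)⟩ ?_)
      · exact Finset.coe_subset.2 (Finset.subset_biUnion_of_mem T (Finset.mem_univ h))
      · rintro a ⟨_, m, _, rfl⟩
        exact ⟨m, rfl⟩
  rw [Module.Finite.iff_addGroup_fg]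
  refine ⟨⟨S, ?_⟩⟩
  rw [eq_top_iff]
  rintro x -
  exact x.induction_cls (fun V => key _ V rfl) (fun _ => neg_mem) fun _ _ => add_mem

/-! ### The traces on a bundle as a central element of a group algebra. -/

section TraceDirectSum

theorem trace_directSum {K ι : Type*} [Field K] [Fintype ι] [DecidableEq ι] {M : ι → Type*}
    [∀ i, AddCommGroup (M i)] [∀ i, Module K (M i)] [∀ i, Module.Finite K (M i)]
    (f : (⨁ i, M i) →ₗ[K] ⨁ i, M i) :
    LinearMap.trace K _ f =
      ∑ i, LinearMap.trace K _ (DirectSum.component K ι M i ∘ₗ f ∘ₗ DirectSum.lof K ι M i) := by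
  have hid : f = ∑ i, (f ∘ₗ DirectSum.lof K ι M i) ∘ₗ DirectSum.component K ι M i := by
    refine LinearMap.ext fun x => ?_
    rw [LinearMap.sum_apply]
    simp only [LinearMap.comp_apply]
    rw [← map_sum]
    congr 1
    exact (DirectSum.sum_univ_of x).symm
  conv_lhs => rw [hid]
  rw [map_sum]
  exact Finset.sum_congr rfl fun i _ => LinearMap.trace_comp_comm' _ _

end TraceDirectSum

namespace EqBundle

variable {G : Type u} {K : Type v} [Group G] [Field K]

-- Conjugation by `g` permutes the summands `V_y ⊗ W_z` of the fibre, and those that are moved do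
-- not contribute to the trace. A summand stays in place exactly when `y` commutes with `g`, and
-- then contributes the product of the two traces.
open Classical in
theorem tr_conv [Finite G] (V W : EqBundle G K) (g : G) [Fintype (CG g)] (a : CG g) :
    (V.conv W).tr g a = ∑ y : CG g, V.tr g y * W.tr g (y⁻¹ * a) := by
  let := Fintype.ofFinite (FactPair (a : G))
  -- The fibres depend on the base point, so the trace is transported along an equality of points
  -- once and for all.
  have hW : ∀ {b : G} {y : CG g}, (b = (y : G)) → ∀ hb : SemiconjBy g b b,
      LinearMap.trace K (W.fib b) (W.act g hb) = W.tr g y := by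
    rintro _ y rfl hb
    rfl
  have hfix : ∀ p : FactPair (a : G), ∀ hp : p.1.1 ∈ CG g,
      LinearMap.trace K _ (DirectSum.component K (FactPair (a : G))
        (fun p => V.fib p.1.1 ⊗[K] W.fib p.1.2) p ∘ₗ convAct V W g (CG.commute a) ∘ₗ
        DirectSum.lof K (FactPair (a : G)) (fun p => V.fib p.1.1 ⊗[K] W.fib p.1.2) p) =
      V.tr g ⟨p.1.1, hp⟩ * W.tr g (⟨p.1.1, hp⟩⁻¹ * a) := by
    rintro ⟨⟨y, z⟩, hyz⟩ hp
    change y ∈ CG g at hp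
    change y * z = a at hyz
    have hz : z = ((⟨y, hp⟩⁻¹ * a : CG g) : G) := by
      rw [← inv_mul_eq_iff_eq_mul.2 hyz.symm]
      rfl
    have hy : SemiconjBy g y y := CG.commute ⟨y, hp⟩
    have hz' : SemiconjBy g z z := hz ▸ CG.commute (⟨y, hp⟩⁻¹ * a : CG g)
    rw [← hW hz hz', EqBundle.tr, ← LinearMap.trace_tensorProduct']
    congr 1
    refine TensorProduct.ext' fun m n => ?_
    have := convAct_mk V W g (CG.commute a) hyz hyz hy hz' m n
    refine (congr_arg (DirectSum.component K _ _ _) this).trans ?_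
    exact DirectSum.component.lof_self _ _ _
  have hnot : ∀ p : FactPair (a : G), p.1.1 ∉ CG g →
      LinearMap.trace K _ (DirectSum.component K (FactPair (a : G))
        (fun p => V.fib p.1.1 ⊗[K] W.fib p.1.2) p ∘ₗ convAct V W g (CG.commute a) ∘ₗ
        DirectSum.lof K (FactPair (a : G)) (fun p => V.fib p.1.1 ⊗[K] W.fib p.1.2) p) = 0 := by
    intro p hp
    have hne : p.conj g (CG.commute a) ≠ p := fun h => hp <| by
      have h1 : g * p.1.1 * g⁻¹ = p.1.1 := congr_arg (fun q => q.1.1) h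
      rw [mul_inv_eq_iff_eq_mul] at h1
      exact Subgroup.mem_centralizer_singleton_iff.2 h1.symm
    convert map_zero (LinearMap.trace K (V.fib p.1.1 ⊗[K] W.fib p.1.2))
    refine LinearMap.ext fun t => ?_
    simp only [LinearMap.comp_apply, convAct]
    erw [DirectSum.toModule_lof]
    exact DirectSum.of_eq_of_ne _ _ _ hne.symm
  change LinearMap.trace K _ (convAct V W g (CG.commute a)) = _
  rw [trace_directSum, ← Finset.sum_filter_of_ne (p := fun p : FactPair (a : G) => p.1.1 ∈ CG g)
    (fun p _ hp => by_contra fun h => hp (hnot p h))]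
  symm
  refine Finset.sum_bij (fun y _ => ⟨((y : G), ((y⁻¹ * a : CG g) : G)), by simp⟩) ?_ ?_ ?_ ?_
  · intro y _
    exact Finset.mem_filter.2 ⟨Finset.mem_univ _, y.2⟩
  · intro y _ y' _ h
    exact Subtype.ext (congr_arg (fun q => q.1.1) h)
  · intro p hp
    refine ⟨⟨p.1.1, (Finset.mem_filter.1 hp).2⟩, Finset.mem_univ _, Subtype.ext (Prod.ext rfl ?_)⟩
    exact inv_mul_eq_iff_eq_mul.2 p.2.symm
  · intro y _
    rw [hfix _ y.2]

theorem tr_unit_one (g : G) : (unit G K).tr g 1 = 1 := by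
  rw [EqBundle.tr]
  have : (unit G K).act g (CG.commute (1 : CG g)) = LinearMap.id := rfl
  rw [this, LinearMap.trace_id]
  change (Module.finrank K (PLift (((1 : CG g) : G) = 1) → ULift.{u} K) : K) = 1
  have : Unique (PLift (((1 : CG g) : G) = 1)) := ⟨⟨⟨rfl⟩⟩, fun _ => rfl⟩
  rw [(LinearEquiv.funUnique _ K (ULift.{u} K)).finrank_eq, ULift.moduleEquiv.finrank_eq]
  simp

theorem tr_unit_of_ne (g : G) {a : CG g} (ha : a ≠ 1) : (unit G K).tr g a = 0 := by
  have : Subsingleton ((unit G K).fib a) :=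
    ⟨fun m n => funext fun i : PLift ((a : G) = 1) => absurd (Subtype.ext i.down) ha⟩
  rw [EqBundle.tr, Subsingleton.elim ((unit G K).act g _) 0, map_zero]

theorem tr_conj_self (V : EqBundle G K) (g : G) (a b : CG g) :
    V.tr g (b * a * b⁻¹) = V.tr g a :=
  V.tr_conj (show SemiconjBy (b : G) g g from (CG.commute b).eq.symm) a

variable [Finite G]

/-- The element `∑_{a ∈ C_G(g)} Tr(g, V_a) a` of the group algebra of `C_G(g)`. -/
def elt (V : EqBundle G K) (g : G) : MonoidAlgebra K (CG g) := .ofFun (V.tr g)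

theorem elt_mem_center (V : EqBundle G K) (g : G) :
    V.elt g ∈ Subalgebra.center K (MonoidAlgebra K (CG g)) :=
  MonoidAlgebra.mem_center_iff_coeff.2 fun a b => V.tr_conj_self g a b

/-- The sum in `tr_conv` is the coefficient of a product in the group algebra. This is the source of
the multiplicativity of `Ψ`. -/
theorem elt_conv (V W : EqBundle G K) (g : G) : (V.conv W).elt g = V.elt g * W.elt g := by
  let := Fintype.ofFinite (CG g)
  ext a
  rw [MonoidAlgebra.coeff_mul_eq_sum]
  exact tr_conv V W g a

theorem elt_unit (g : G) : (unit G K).elt g = 1 := by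
  classical
  ext a
  by_cases ha : a = 1
  · subst ha
    rw [MonoidAlgebra.coeff_one_one]
    exact tr_unit_one g
  · have : (1 : MonoidAlgebra K (CG g)).coeff a = 0 := by
      simp [MonoidAlgebra.one_def, Ne.symm ha]
    rw [this]
    exact tr_unit_of_ne g ha

end EqBundle

/-! ### Multiplicativity of `Ψ`. -/

section PsiHom

variable {G : Type u} {K : Type v} [Group G] [Field K] [Finite G]

theorem psiHom_cls_eq_omega (P : IrrPair G K) (V : EqBundle G K) :
    psiHom P (KG.cls V) = omega P.γ (V.elt P.g) := psiHom_cls P V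

/-- `Ψ_{g,γ}` is multiplicative. -/
theorem exists_ringHom_eq_psiHom [CharZero K] (hK : SplitForSubgroups G K) (P : IrrPair G K) :
    ∃ ψ : KG G K →+* K, ∀ x, ψ x = psiHom P x := by
  obtain ⟨W, _, _, _, ρ, hρ, hγ⟩ := P.irr
  have hs : IsSplitRep ρ := hK (CG P.g) W ρ hρ
  have := hρ.nontrivial
  have hinj : Function.Injective (algebraMap K (Module.End K W)) :=
    (algebraMap K (Module.End K W)).injective
  have hact : ∀ x ∈ Subalgebra.center K (MonoidAlgebra K (CG P.g)),
      algebraMap K (Module.End K W) (omega P.γ x) = ρ.asAlgebraHom x := fun x hx => by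
    rw [← hγ]
    exact (asAlgebraHom_eq_omega_smul hρ hs hx).symm
  refine ⟨{ psiHom P with
    map_one' := ?_
    map_mul' := fun x y => ?_ }, fun _ => rfl⟩
  · change psiHom P (KG.cls (EqBundle.unit G K)) = 1
    rw [psiHom_cls_eq_omega, EqBundle.elt_unit]
    refine hinj ?_
    rw [hact _ (one_mem _), map_one, map_one]
  · change psiHom P (x * y) = psiHom P x * psiHom P y
    induction x using KG.induction_cls with
    | cls V =>
      induction y using KG.induction_cls with
      | cls W =>
        rw [KG.cls_mul_cls, psiHom_cls_eq_omega, psiHom_cls_eq_omega, psiHom_cls_eq_omega,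
          EqBundle.elt_conv]
        refine hinj ?_
        rw [map_mul (algebraMap K _), hact _ (V.elt_mem_center _), hact _ (W.elt_mem_center _),
          hact _ (mul_mem (V.elt_mem_center _) (W.elt_mem_center _)), map_mul]
      | neg y h => rw [mul_neg, map_neg, map_neg, h, mul_neg]
      | add y y' h h' => rw [mul_add, map_add, map_add, h, h', mul_add]
    | neg x h => rw [neg_mul, map_neg, map_neg, h, neg_mul]
    | add x x' h h' => rw [add_mul, map_add, map_add, h, h', add_mul]

variable {O : Type*} [CommRing O] [Algebra O K]

theorem Psi_toKKG_tmul (P : IrrPair G K) (r : O) (x : KG G K) :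
    Psi (MG.mk P) (toKKG G K O (r ⊗ₜ x)) = algebraMap O K r * psiHom P x := by
  rw [toKKG, Algebra.TensorProduct.map_tmul, Psi, LinearMap.liftBaseChange_tmul]
  rfl

/-- As a ring homomorphism to a field, `Ψ` takes only the values 0 and 1 on idempotents, which is
how it detects blocks. -/
theorem exists_ringHom_eq_Psi [CharZero K] (hK : SplitForSubgroups G K) (m : MG G K) :
    ∃ Φ : O ⊗[ℤ] KG G K →+* K, ∀ z, Φ z = Psi m (toKKG G K O z) := by
  obtain ⟨P, rfl⟩ : ∃ P, MG.mk P = m := Quotient.exists_rep m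
  obtain ⟨ψ, hψ⟩ := exists_ringHom_eq_psiHom hK P
  refine ⟨(Algebra.TensorProduct.productMap (algebraMap O K).toIntAlgHom ψ.toIntAlgHom).toRingHom,
    fun z => ?_⟩
  induction z with
  | zero => rw [map_zero, map_zero, map_zero]
  | add x y hx hy => rw [map_add, map_add, map_add, hx, hy]
  | tmul r x =>
    rw [Psi_toKKG_tmul, ← hψ]
    exact Algebra.TensorProduct.productMap_apply_tmul _ _ r x

end PsiHom

/-! ### The `p'`-part as a power. -/

section PPrimePart

variable {G : Type u} [Group G]

/-- The `p'`-part of `g` is a power of `g`. -/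
theorem IsPPrimePart.exists_pow_eq [Finite G] {p : ℕ} {g s : G} (h : IsPPrimePart p g s) :
    ∃ (w : G) (n m d : ℕ), g = w * s ∧ w ^ p ^ n = 1 ∧ m ≠ 0 ∧ g ^ (p ^ n * m) = 1 ∧
      g ^ (1 + m * d) = s := by
  obtain ⟨w, h1, h2, ⟨n, hn⟩, hc⟩ := h
  have hws : Commute w s := h1.symm.trans h2
  have hw : w ^ p ^ n = 1 := hn ▸ pow_orderOf_eq_one w
  have hm : orderOf s ≠ 0 := (orderOf_pos s).ne'
  have hp : p ^ n ≠ 0 := hn ▸ (orderOf_pos w).ne'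
  -- An exponent that is 1 modulo the order of `s` and 0 modulo `p ^ n` fixes `s` and kills `w`.
  -- Adding `p ^ n * orderOf s` makes it at least 1, so that it has the form `1 + m * d` used for
  -- the trace congruence.
  obtain ⟨k, hk1, hk2⟩ := Nat.chineseRemainder (hc.pow_right n) 1 0
  have hk3 : 1 ≡ k + p ^ n * orderOf s [MOD orderOf s] := by
    refine (hk1.symm).trans ?_
    simp [Nat.ModEq]
  have hpos : 1 ≤ k + p ^ n * orderOf s := by
    have := Nat.mul_pos (Nat.pos_of_ne_zero hp) (Nat.pos_of_ne_zero hm)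
    omega
  obtain ⟨d, hd⟩ := (Nat.modEq_iff_dvd' hpos).1 hk3
  have hd' : 1 + orderOf s * d = k + p ^ n * orderOf s := by omega
  refine ⟨w, n, orderOf s, d, h1, hw, hm, ?_, ?_⟩
  · rw [h1, hws.mul_pow, pow_mul, hw, one_pow, one_mul, mul_comm, pow_mul, pow_orderOf_eq_one,
      one_pow]
  · have h3 : w ^ (1 + orderOf s * d) = 1 := by
      obtain ⟨j, hj⟩ := (Nat.modEq_zero_iff_dvd.1 hk2)
      rw [hd', hj, ← mul_add, pow_mul, hw, one_pow]
    rw [h1, hws.mul_pow, h3, one_mul, pow_add, pow_mul, pow_orderOf_eq_one, one_pow, mul_one,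
      pow_one]

theorem IsPPrimePart.refl {p : ℕ} {s : G} (hs : (orderOf s).Coprime p) : IsPPrimePart p s s :=
  ⟨1, by simp, by simp, ⟨0, by simp⟩, hs⟩

theorem CG_le_of_pow_eq {g s : G} {c : ℕ} (h : g ^ c = s) : CG g ≤ CG s := by
  intro a ha
  rw [Subgroup.mem_centralizer_singleton_iff] at ha ⊢
  rw [← h]
  exact (Commute.pow_right ha c).eq

end PPrimePart

/-! ### Integrality and congruence of the traces on fibres. -/

section TraceCongruence

variable {G : Type u} {K : Type v} [Group G] [Field K]

theorem EqBundle.act_pow (V : EqBundle G K) {g a : G} (h : SemiconjBy g a a) (j : ℕ)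
    (hj : SemiconjBy (g ^ j) a a) : (V.act g h : Module.End K (V.fib a)) ^ j = V.act (g ^ j) hj := by
  induction j with
  | zero =>
    refine LinearMap.ext fun m => ?_
    rw [pow_zero, V.act_congr (pow_zero g) hj (SemiconjBy.one_left a), V.act_one]
    rfl
  | succ j ih =>
    refine LinearMap.ext fun m => ?_
    have hj' : SemiconjBy (g ^ j) a a := Commute.pow_left h j
    rw [pow_succ, ih hj', Module.End.mul_apply, V.act_act hj' h (hj'.mul_left h)]
    exact V.act_congr (pow_succ g j).symm _ _ _

variable {O : Type*} [CommRing O] [Algebra O K] [IsIntegrallyClosedIn O K]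
  (𝔭 : Ideal O) [𝔭.IsMaximal] {p : ℕ}

/-- The traces on the fibres at `g` and at its `p'`-part are integral and congruent. -/
theorem exists_tr_sub_tr_mem (hpp : p.Prime) (hp : (p : O) ∈ 𝔭) (V : EqBundle G K) {g s : G}
    {n m d : ℕ} (hm : m ≠ 0) (hg : g ^ (p ^ n * m) = 1) (hs : g ^ (1 + m * d) = s)
    (a : CG g) (a' : CG s) (haa : (a : G) = a') :
    ∃ r r' : O, algebraMap O K r = V.tr g a ∧ algebraMap O K r' = V.tr s a' ∧ r - r' ∈ 𝔭 := by
  subst hs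
  obtain ⟨a', ha'⟩ := a'
  subst haa
  have h := CG.commute a
  have hT : (V.act g h : Module.End K (V.fib a)) ^ (p ^ n * m) = 1 := by
    rw [V.act_pow h _ (Commute.pow_left h _)]
    refine LinearMap.ext fun x => ?_
    exact (V.act_congr hg _ (SemiconjBy.one_left _) x).trans (V.act_one _ x)
  obtain ⟨r, r', hr, hr', hrr⟩ := exists_trace_sub_trace_pow_mem (O := O) 𝔭 hp (d := d) hpp hm
    (V.act g h : Module.End K (V.fib a)) hT
  refine ⟨r, r', hr, ?_, hrr⟩
  rw [hr', V.act_pow h _ (Commute.pow_left h _)]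
  rfl

/-- The element `∑ Tr(g, V_a) a` of the group algebra has integral coefficients. -/
theorem exists_toKAlg_eq_elt [Finite G] (hpp : p.Prime) (hp : (p : O) ∈ 𝔭) (V : EqBundle G K)
    (g : G) : ∃ z : Subalgebra.center O (MonoidAlgebra O (CG g)),
      toKAlg K (CG g) (z : MonoidAlgebra O (CG g)) = V.elt g := by
  have h : ∀ a : CG g, ∃ r : O, algebraMap O K r = V.tr g a := fun a => by
    -- Only integrality is needed here, so `g` is compared with itself: `m` is the order of `g`, and
    -- `n = d = 0`.
    obtain ⟨r, _, hr, _⟩ := exists_tr_sub_tr_mem 𝔭 hpp hp V (n := 0) (d := 0)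
      (orderOf_pos g).ne' (by simp [pow_orderOf_eq_one]) (by simp) a a rfl
    exact ⟨r, hr⟩
  choose r hr using h
  refine ⟨⟨.ofFun r, MonoidAlgebra.mem_center_iff_coeff.2 fun a b => ?_⟩, ?_⟩
  · refine IsIntegralClosure.algebraMap_injective O O K ?_
    change algebraMap O K (r _) = algebraMap O K (r _)
    rw [hr, hr, V.tr_conj_self]
  · ext a
    rw [coeff_toKAlg]
    exact hr a

end TraceCongruence

/-! ### Characters of the centre obtained through the Brauer map. -/

section Brauer

variable {R : Type*} [CommRing R]

theorem coeff_brauerMap {G : Type*} [Group G] (H L : Subgroup G) (x : MonoidAlgebra R H) (l : L)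
    (hl : (l : G) ∈ H) : (brauerMap R H L x).coeff l = x.coeff ⟨l, hl⟩ := by
  classical
  rw [brauerMap, Finsupp.sum, MonoidAlgebra.coeff_sum, Finsupp.finsetSum_apply,
    Finset.sum_eq_single ⟨l, hl⟩]
  · simp
  · intro h _ hne
    split_ifs with hL
    · have : (⟨h, hL⟩ : L) ≠ l := fun e => hne (Subtype.ext (congr_arg (fun i : L => (i : G)) e))
      simp [this]
    · rfl
  · intro h0
    rw [Finsupp.notMem_support_iff] at h0
    simp [h0]

/-- Truncation followed by a linear character, modulo a maximal ideal, is a homomorphism. -/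
theorem exists_ringHom_truncate {H L : Type*} [Group H] [Group L] [Finite H] [Finite L] (ι : L →* H)
    (hι : Function.Injective ι) {p : ℕ} [Fact p.Prime] (I : Ideal R) (hp : (p : R) ∈ I) (w : H)
    {n : ℕ} (hw : w ^ p ^ n = 1) (hwι : ∀ h : H, h ∈ ι.range ↔ Commute w h)
    (φ : Subalgebra.center R (MonoidAlgebra R L) →ₐ[R] R) :
    ∃ ψ : Subalgebra.center R (MonoidAlgebra R H) →+* R ⧸ I,
      ∀ x, ψ x = Ideal.Quotient.mk I (φ (truncate ι hι x)) := by
  have hone : truncate (R := R) ι hι 1 = 1 := by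
    classical
    refine Subtype.ext (MonoidAlgebra.ext (Finsupp.ext fun a => ?_))
    change (1 : MonoidAlgebra R H).coeff (ι a) = (1 : MonoidAlgebra R L).coeff a
    by_cases ha : a = 1
    · simp [ha]
    · have : ι a ≠ 1 := fun h => ha (hι (by rw [h, map_one]))
      simp [MonoidAlgebra.one_def, Ne.symm ha, this.symm]
  refine ⟨{ toFun := fun x => Ideal.Quotient.mk I (φ (truncate ι hι x))
            map_one' := by rw [hone, map_one, map_one]
            map_zero' := by rw [map_zero, map_zero, map_zero]
            map_add' := fun x y => by rw [map_add, map_add, map_add]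
            map_mul' := fun x y => ?_ }, fun _ => rfl⟩
  -- Truncation fails to be multiplicative by an element with coefficients in `I`, and `φ` maps such
  -- an element into `I`.
  rw [← map_mul, ← map_mul, Ideal.Quotient.eq, ← map_sub]
  exact map_mem_of_coeff_mem φ.toLinearMap I _
    fun l => coeff_truncate_mul_sub_mem ι hι I hp w hw hwι x y l

end Brauer

/-! ### The character modulo `𝔭` attached to an element of `𝓑_G(s,e)`. -/

section BlockSet

variable {G : Type u} {K : Type v} [Group G] [Field K] [Finite G] [CharZero K]
  {O : Type*} [CommRing O] [Algebra O K] [IsIntegrallyClosedIn O K]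
  (𝔭 : Ideal O) [𝔭.IsMaximal] {p : ℕ} [Fact p.Prime]

theorem IsBlockIdempotent.mem_center {R H : Type*} [CommRing R] [Group H] {e : MonoidAlgebra R H}
    (he : IsBlockIdempotent e) : e ∈ Subalgebra.center R (MonoidAlgebra R H) :=
  Subalgebra.mem_center_iff.2 (Subring.mem_center_iff.1 he.1)

theorem IsBlockIdempotent.isPrimitiveIdempotent {R H : Type*} [CommRing R] [Group H]
    {e : MonoidAlgebra R H} (he : IsBlockIdempotent e) :
    IsPrimitiveIdempotent (⟨e, he.mem_center⟩ : Subalgebra.center R (MonoidAlgebra R H)) := he.2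

/-- The pairs `(s, σ)` with `σ ∈ Irr(K C_G(s) e)` belong to `𝓑_G(s,e)`. -/
theorem mk_mem_blockSet {G : Type u} {K : Type v} [Group G] [Field K] {O : Type*}
    [CommRing O] [Algebra O K] (𝔭 : Ideal O) {p : ℕ} {s : G} (hs : (orderOf s).Coprime p)
    {e : MonoidAlgebra O (CG s)} (he : IsBlockIdempotent e) {σ : CG s → K} (hσ : IsIrrCharOf (toKAlg K (CG s) e) σ) :
    MG.mk ⟨s, σ, hσ.isIrrChar⟩ ∈ BlockSet K p 𝔭 s e := by
  refine ⟨_, rfl, IsPPrimePart.refl hs, e, ⟨{e}, by simpa using he, ?_, by simp⟩, hσ⟩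
  rw [Finset.sum_singleton]
  ext a
  exact coeff_brauerMap _ _ _ _ a.2

/-- The homomorphism modulo `𝔭` on the centre of the group algebra of `C_G(s)` attached to an
element of `𝓑_G(s,e)`. -/
theorem exists_ringHom_of_mem_blockSet (hK : SplitForSubgroups G K) (hp : (p : O) ∈ 𝔭) {s : G}
    {e : MonoidAlgebra O (CG s)} (he : IsBlockIdempotent e) {m : MG G K}
    (hm : m ∈ BlockSet K p 𝔭 s e) :
    ∃ (P : IrrPair G K) (ψ : Subalgebra.center O (MonoidAlgebra O (CG s)) →+* O ⧸ 𝔭),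
      MG.mk P = m ∧ ψ ⟨e, he.mem_center⟩ = 1 ∧
      (∀ r, ψ (algebraMap O _ r) = Ideal.Quotient.mk 𝔭 r) ∧
      ∀ (V : EqBundle G K) (z : Subalgebra.center O (MonoidAlgebra O (CG s))),
        toKAlg K (CG s) (z : MonoidAlgebra O (CG s)) = V.elt s →
        ∃ c : O, algebraMap O K c = psiHom P (KG.cls V) ∧ Ideal.Quotient.mk 𝔭 c = ψ z := by
  obtain ⟨P, rfl, hPs, β, ⟨S, hS, hSe, rfl⟩, W, _, _, _, ρ, hρ, hβ, hγ⟩ := hm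
  have hinj : Function.Injective (algebraMap O K) := IsIntegralClosure.algebraMap_injective O O K
  have hpp : p.Prime := Fact.out
  obtain ⟨w, n, k, d, hgw, hw, hk, hg1, hgs⟩ := hPs.exists_pow_eq
  have hle : CG P.g ≤ CG s := CG_le_of_pow_eq hgs
  have hws : w ∈ CG s := by
    have h1 : P.g ∈ CG s := hle (Subgroup.mem_centralizer_singleton_iff.2 rfl)
    have h2 : s ∈ CG s := Subgroup.mem_centralizer_singleton_iff.2 rfl
    rw [eq_mul_inv_of_mul_eq hgw.symm]
    exact mul_mem h1 (inv_mem h2)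
  let ι : CG P.g →* CG s := Subgroup.inclusion hle
  have hι : Function.Injective ι := Subgroup.inclusion_injective hle
  -- Since `g = w * s`, an element commuting with `s` commutes with `g` exactly when it commutes
  -- with `w`. Thus `C_G(g)` is the centralizer of a `p`-element of `C_G(s)`, as the Brauer argument
  -- requires.
  have hwι : ∀ h : CG s, h ∈ ι.range ↔ Commute (⟨w, hws⟩ : CG s) h := by
    intro h
    have hhs : Commute (h : G) s := Subgroup.mem_centralizer_singleton_iff.1 h.2
    have h1 : Commute (⟨w, hws⟩ : CG s) h ↔ Commute w (h : G) := Subtype.ext_iff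
    rw [h1]
    constructor
    · rintro ⟨l, rfl⟩
      have hl : Commute (l : G) P.g := Subgroup.mem_centralizer_singleton_iff.1 l.2
      rw [eq_mul_inv_of_mul_eq hgw.symm]
      exact (hl.mul_right hhs.inv_right).symm
    · intro hc
      refine ⟨⟨h, Subgroup.mem_centralizer_singleton_iff.2 ?_⟩, rfl⟩
      rw [hgw]
      exact (hc.symm.mul_right hhs).eq
  have hsplit : IsSplitRep ρ := hK (CG P.g) W ρ hρ
  obtain ⟨φ, hφ⟩ := exists_centralCharacter (O := O) hρ hsplit
  rw [hγ] at hφ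
  obtain ⟨ψ, hψ⟩ := exists_ringHom_truncate ι hι 𝔭 hp ⟨w, hws⟩
    (n := n) (Subtype.ext hw) hwι φ
  have hβc : ∑ f ∈ S, f ∈ Subalgebra.center O (MonoidAlgebra O (CG P.g)) :=
    sum_mem fun f hf => (hS f hf).mem_center
  refine ⟨P, ψ, rfl, ?_, fun r => ?_, fun V z hz => ?_⟩
  -- The idempotent `β` acts as the identity, so its central character value is 1. The truncation of
  -- `e` agrees with `β` modulo `𝔭` coefficient by coefficient, so `ψ` maps `e` to 1 as well.
  · have h1 : φ ⟨∑ f ∈ S, f, hβc⟩ = 1 := by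
      have := hρ.nontrivial
      have h2 := asAlgebraHom_eq_omega_smul hρ hsplit (toKAlg_mem_center hβc)
      rw [hβ, hγ] at h2
      refine hinj ?_
      rw [hφ, map_one]
      exact (algebraMap K (Module.End K W)).injective (by rw [← h2, map_one])
    rw [hψ, ← map_one (Ideal.Quotient.mk 𝔭), ← h1, Ideal.Quotient.eq, ← map_sub]
    refine map_mem_of_coeff_mem φ.toLinearMap 𝔭 _ fun a => ?_
    have h2 := congr_arg (fun x => x.coeff a) hSe
    simp only [MonoidAlgebra.coeff_sum, Finsupp.finsetSum_apply] at h2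
    rw [coeff_brauerMap _ _ _ _ (hle a.2)] at h2
    rw [← Ideal.Quotient.eq_zero_iff_mem]
    change Ideal.Quotient.mk 𝔭 (e.coeff (ι a) - (∑ f ∈ S, f).coeff a) = 0
    rw [map_sub, sub_eq_zero, MonoidAlgebra.coeff_sum, Finsupp.finsetSum_apply, map_sum]
    have h3 : (⟨a, hle a.2⟩ : CG s) = ι a := rfl
    simpa [reduction, h3] using h2
  · have h1 : truncate (R := O) ι hι (algebraMap O _ r) = r • truncate ι hι 1 := by
      rw [Algebra.algebraMap_eq_smul_one, map_smul]
    have h2 : ψ 1 = 1 := map_one ψ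
    rw [hψ] at h2
    rw [hψ, h1, map_smul, smul_eq_mul, map_mul, h2, mul_one]
  -- The value of `Ψ` is `φ z'`, and the trace congruence says that `z'` and the truncation of `z`
  -- have the same coefficients modulo `𝔭`.
  · obtain ⟨z', hz'⟩ := exists_toKAlg_eq_elt (O := O) 𝔭 hpp hp V P.g
    refine ⟨φ z', ?_, ?_⟩
    · rw [hφ, hz', psiHom_cls_eq_omega]
    · rw [hψ, Ideal.Quotient.eq, ← map_sub]
      refine map_mem_of_coeff_mem φ.toLinearMap 𝔭 _ fun a => ?_
      obtain ⟨r, r', hr, hr', hrr⟩ := exists_tr_sub_tr_mem (O := O) 𝔭 hpp hp V hk hg1 hgs a (ι a) rfl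
      have e1 : (z' : MonoidAlgebra O (CG P.g)).coeff a = r := hinj <| by
        rw [hr, ← coeff_toKAlg, hz']
        rfl
      have e2 : (z : MonoidAlgebra O (CG s)).coeff (ι a) = r' := hinj <| by
        rw [hr', ← coeff_toKAlg, hz]
        rfl
      change (z' : MonoidAlgebra O (CG P.g)).coeff a - (z : MonoidAlgebra O (CG s)).coeff (ι a) ∈ 𝔭
      rwa [e1, e2]

end BlockSet

/-! ### Comparison of two elements of `𝓑_G(s,e)` over the integers of a `p`-adic field. -/

section Padic

/-- By integrality, `𝔭` contracts to a maximal ideal of the local ring `ℤ_[p]`, which is generated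
by `p`. -/
theorem natCast_mem_of_isMaximal {p : ℕ} [Fact p.Prime] {K : Type*} [Field K] [Algebra ℤ_[p] K]
    (𝔭 : Ideal (integralClosure ℤ_[p] K)) [𝔭.IsMaximal] :
    (p : integralClosure ℤ_[p] K) ∈ 𝔭 := by
  have h1 : (𝔭.comap (algebraMap ℤ_[p] (integralClosure ℤ_[p] K))).IsMaximal :=
    Ideal.isMaximal_comap_of_isIntegral_of_isMaximal 𝔭
  have h2 : (p : ℤ_[p]) ∈ 𝔭.comap (algebraMap ℤ_[p] (integralClosure ℤ_[p] K)) := by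
    rw [IsLocalRing.eq_maximalIdeal h1, PadicInt.maximalIdeal_eq_span_p]
    exact Ideal.mem_span_singleton_self _
  simpa using h2

variable {G : Type u} [Group G] [Finite G] {p : ℕ} [Fact p.Prime]
  {K : Type v} [Field K] [Algebra ℚ_[p] K] [FiniteDimensional ℚ_[p] K]
  [Algebra ℤ_[p] K] [IsScalarTower ℤ_[p] ℚ_[p] K]

/-- All elements of `𝓑_G(s,e)` define the same character modulo `𝔭`. -/
theorem Psi_sub_Psi_mem (hK : SplitForSubgroups G K)
    (𝔭 : Ideal (integralClosure ℤ_[p] K)) [h𝔭 : 𝔭.IsMaximal] {s : G}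
    {e : MonoidAlgebra (integralClosure ℤ_[p] K) (CG s)} (he : IsBlockIdempotent e)
    {m m' : MG G K} (hm : m ∈ BlockSet K p 𝔭 s e) (hm' : m' ∈ BlockSet K p 𝔭 s e)
    (z : integralClosure ℤ_[p] K ⊗[ℤ] KG G K) :
    ∃ c ∈ 𝔭, Psi m (toKKG G K _ z) - Psi m' (toKKG G K _ z) =
      algebraMap (integralClosure ℤ_[p] K) K c := by
  have : CharZero K := charZero_of_injective_algebraMap (algebraMap ℚ_[p] K).injective
  have hp := natCast_mem_of_isMaximal 𝔭
  have hpp : p.Prime := Fact.out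
  obtain ⟨P, ψ, rfl, hψe, hψr, hψ⟩ := exists_ringHom_of_mem_blockSet 𝔭 hK hp he hm
  obtain ⟨P', ψ', rfl, hψe', hψr', hψ'⟩ := exists_ringHom_of_mem_blockSet 𝔭 hK hp he hm'
  have hfin : Module.Finite ℤ_[p] (integralClosure ℤ_[p] K) :=
    IsIntegralClosure.finite ℤ_[p] ℚ_[p] K _
  have hnoeth : IsNoetherianRing (integralClosure ℤ_[p] K) := IsNoetherianRing.of_finite ℤ_[p] _
  have := MonoidAlgebra.module_finite (H := CG s) (R := integralClosure ℤ_[p] K)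
  have hfin' : Module.Finite (integralClosure ℤ_[p] K)
      (Subalgebra.center (integralClosure ℤ_[p] K)
        (MonoidAlgebra (integralClosure ℤ_[p] K) (CG s))) :=
    Module.Finite.of_injective (Subalgebra.val _).toLinearMap Subtype.val_injective
  have : Module.Finite ℤ_[p] (Subalgebra.center (integralClosure ℤ_[p] K)
        (MonoidAlgebra (integralClosure ℤ_[p] K) (CG s))) :=
    Module.Finite.trans (integralClosure ℤ_[p] K) _
  let := Ideal.Quotient.field 𝔭
  have hp0 : (p : integralClosure ℤ_[p] K ⧸ 𝔭) = 0 := by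
    rw [← map_natCast (Ideal.Quotient.mk 𝔭)]
    exact Ideal.Quotient.eq_zero_iff_mem.2 hp
  -- Both homomorphisms are reduction modulo `𝔭` on scalars, so every value of `ψ` is attained by
  -- both at one and the same scalar.
  have heq : ψ = ψ' := ringHom_eq_of_isPrimitiveIdempotent hp0 he.isPrimitiveIdempotent ψ ψ' hψe hψe'
    fun x => by
      obtain ⟨r, hr⟩ := Ideal.Quotient.mk_surjective (ψ x)
      exact ⟨algebraMap _ _ r, by rw [hψr, hr], by rw [hψr', hr]⟩
  have key : ∀ x : KG G K, ∃ c ∈ 𝔭, psiHom P x - psiHom P' x =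
      algebraMap (integralClosure ℤ_[p] K) K c := by
    intro x
    induction x using KG.induction_cls with
    | cls V =>
      -- The same element `z`, built from `s` only, computes both values modulo `𝔭`.
      obtain ⟨z, hz⟩ := exists_toKAlg_eq_elt 𝔭 hpp hp V s
      obtain ⟨c, hc, hcz⟩ := hψ V z hz
      obtain ⟨c', hc', hcz'⟩ := hψ' V z hz
      refine ⟨c - c', ?_, by rw [map_sub, hc, hc']⟩
      rw [← Ideal.Quotient.eq, hcz, hcz', heq]
    | neg x h =>
      obtain ⟨c, hc, h⟩ := h
      exact ⟨-c, neg_mem hc, by rw [map_neg, map_neg, map_neg, ← h]; ring⟩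
    | add x y hx hy =>
      obtain ⟨c, hc, hx⟩ := hx
      obtain ⟨c', hc', hy⟩ := hy
      exact ⟨c + c', add_mem hc hc', by rw [map_add, map_add, map_add, ← hx, ← hy]; ring⟩
  induction z with
  | zero => exact ⟨0, zero_mem _, by simp⟩
  | tmul r x =>
    obtain ⟨c, hc, h⟩ := key x
    refine ⟨r * c, 𝔭.mul_mem_left r hc, ?_⟩
    rw [Psi_toKKG_tmul, Psi_toKKG_tmul, map_mul, ← h, mul_sub]
  | add x y hx hy =>
    obtain ⟨c, hc, hx⟩ := hx
    obtain ⟨c', hc', hy⟩ := hy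
    exact ⟨c + c', add_mem hc hc', by rw [map_add, map_add, map_add, map_add, ← hx, ← hy]; ring⟩

end Padic

end

theorem mainTheorem2 {G : Type u} [Group G] [Finite G] (p : ℕ) [Fact p.Prime]
    {K : Type v} [Field K] [Algebra ℚ_[p] K] [FiniteDimensional ℚ_[p] K]
    [Algebra ℤ_[p] K] [IsScalarTower ℤ_[p] ℚ_[p] K] (hK : SplitForSubgroups G K)
    (𝔭 : Ideal (integralClosure ℤ_[p] K)) (h𝔭 : 𝔭.IsMaximal)
    (s : G) (hs : (orderOf s).Coprime p)
    (e : MonoidAlgebra (integralClosure ℤ_[p] K) (CG s)) (he : IsBlockIdempotent e) :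
    (∀ m ∈ BlockSet K p 𝔭 s e, ∀ m' ∈ BlockSet K p 𝔭 s e,
      ∃ B : Set (MG G K), IsPBlock (integralClosure ℤ_[p] K) B ∧ m ∈ B ∧ m' ∈ B) ∧
    (∀ m ∈ BlockSet K p 𝔭 s e, ∀ (σ : CG s → K) (hσ : IsIrrCharOf (toKAlg K (CG s) e) σ)
      (z : integralClosure ℤ_[p] K ⊗[ℤ] KG G K),
      ∃ c ∈ 𝔭, Psi m (toKKG G K _ z) - Psi (MG.mk ⟨s, σ, hσ.isIrrChar⟩) (toKKG G K _ z) =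
        algebraMap (integralClosure ℤ_[p] K) K c) := by
  refine ⟨fun m hm m' hm' => ?_, fun m hm σ hσ z =>
    Psi_sub_Psi_mem hK 𝔭 he hm (mk_mem_blockSet 𝔭 hs he hσ) z⟩
  have : CharZero K := charZero_of_injective_algebraMap (algebraMap ℚ_[p] K).injective
  have hfin : Module.Finite ℤ_[p] (integralClosure ℤ_[p] K) :=
    IsIntegralClosure.finite ℤ_[p] ℚ_[p] K _
  have hnoeth : IsNoetherianRing (integralClosure ℤ_[p] K) := IsNoetherianRing.of_finite ℤ_[p] _
  have := KG.module_finite G K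
  -- Finite generation of the Grothendieck group enters here: it ensures that there is a primitive
  -- idempotent `b` on which the first `Ψ` is 1.
  have : IsNoetherianRing (integralClosure ℤ_[p] K ⊗[ℤ] KG G K) :=
    IsNoetherianRing.of_finite (integralClosure ℤ_[p] K) _
  obtain ⟨Φ, hΦ⟩ := exists_ringHom_eq_Psi (O := integralClosure ℤ_[p] K) hK m
  obtain ⟨Φ', hΦ'⟩ := exists_ringHom_eq_Psi (O := integralClosure ℤ_[p] K) hK m'
  obtain ⟨b, hb, hb1⟩ := exists_isPrimitiveIdempotent_map_eq_one Φ
  refine ⟨_, ⟨b, hb, rfl⟩, (hΦ b).symm.trans hb1, (hΦ' b).symm.trans ?_⟩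
  have hid : Φ' b * Φ' b = Φ' b := by rw [← map_mul, hb.1.eq]
  -- The second value is idempotent in a field. If it were 0, the congruence would put 1 into `𝔭`.
  refine (mul_eq_left₀ fun h0 => ?_).1 hid
  obtain ⟨c, hc, h⟩ := Psi_sub_Psi_mem hK 𝔭 he hm hm' b
  rw [← hΦ, ← hΦ', hb1, h0, sub_zero] at h
  have hc1 : c = 1 := Subtype.ext h.symm
  exact h𝔭.ne_top ((Ideal.eq_top_iff_one 𝔭).2 (hc1 ▸ hc))
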